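/- Let $d\ge 1$, and let $f$ and $g$ be probability densities with respect to Lebesgue measure on $\mathbb{R}^d$ such that the distributions with densities $f$ and $g$ have compact support. Let $X_1,X_2,\dots$ be IID with density $f$ and $Y_1,Y_2,\dots$ IID with density $g$, the two sequences being independent and defined on one probability space. Let $p\in(0,1)$ and consider sample sizes $(m,n)=(m_k,n_k)$, $k\in\mathbb{N}$, with $m+n\to\infty$ and $m/(m+n)\to p$ as $k\to\infty$. Let $Z_i=X_i$ for $1\le i\le m$ and $Z_{m+j}=Y_j$ for $1\le j\le n$ denote the combined sample of size $m+n$. Let $\mathcal{G}$ be the undirected graph on the combined sample whose edges are the pairs of a greedy matching: match a pair of points at smallest Euclidean distance, remove both points, and repeat until at most one point is left, ties being broken arbitrarily. Let $$\chi_{\mathcal{G}}(\mathbf{Z})=\#\{(i,j): i\le m<j,\ Z_i\to Z_j \text{ in } \mathcal{G}\}+\#\{(i,j): i\le m<j,\ Z_j\to Z_i\text{ in } \mathcal{G}\},$$ where an undirected edge is regarded as an edge in both directions (so $\chi_{\mathcal{G}}(\mathbf{Z})$ is twice the number of matched pairs consisting of one $X$-point and one $Y$-point). Then, almost surely, $$\frac{\chi_{\mathcal{G}}(\mathbf{Z})}{m+n}\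 \longrightarrow\ \int_{\mathbb{R}^d}\frac{2p(1-p)f(z)g(z)}{pf(z)+(1-p)g(z)}\,dz \qquad (k\to\infty),$$ where the integrand is read as $0$ at points where $f=g=0$. -/

import Mathlib

open MeasureTheory ProbabilityTheory Filter Topology

/-- The Borel measure on `ℝ^d` with density `f` with respect to Lebesgue measure. -/
noncomputable def densityMeasure {d : ℕ} (f : EuclideanSpace ℝ (Fin d) → ℝ) :
    Measure (EuclideanSpace ℝ (Fin d)) :=
  volume.withDensity (fun z => ENNReal.ofReal (f z))

/-- `GreedyRun z S G`: the greedy procedure, started with the points `z k`, `k ∈ S`, still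
unmatched, can produce the matching whose pairs are the edges of `G`. As long as at least two
points remain, a closest pair of remaining points (any one of them, if there are ties) is matched
and removed; the procedure stops when at most one point remains. -/
inductive GreedyRun {ι E : Type*} [DecidableEq ι] [PseudoMetricSpace E] (z : ι → E) :
    Finset ι → SimpleGraph ι → Prop
  | base (S : Finset ι) (hS : S.card ≤ 1) : GreedyRun z S ⊥
  | pair (S : Finset ι) (i j : ι) (G : SimpleGraph ι) (hi : i ∈ S) (hj : j ∈ S) (hij : i ≠ j)
      (hmin : ∀ k ∈ S, ∀ l ∈ S, k ≠ l → dist (z i) (z j) ≤ dist (z k) (z l))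
      (hG : GreedyRun z ((S.erase i).erase j) G) :
      GreedyRun z S (SimpleGraph.edge i j ⊔ G)

/-- `G` is the undirected graph of a greedy matching of the finite family of points `z`, for some
way of breaking ties. -/
def IsGreedyMatching {ι E : Type*} [DecidableEq ι] [Fintype ι] [PseudoMetricSpace E] (z : ι → E)
    (G : SimpleGraph ι) : Prop :=
  GreedyRun z Finset.univ G

/-- The combined sample `Z_1, …, Z_{m+n}`: first `x_1, …, x_m`, then `y_1, …, y_n`
(indices start at `0`). -/
def combinedSample {E : Type*} (m n : ℕ) (x y : ℕ → E) : Fin (m + n) → E :=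
  Fin.append (fun i : Fin m => x i) (fun j : Fin n => y j)

/-- `χ`: the number of directed edges `u → v` from the first `m` nodes to the last `n` nodes, plus
the number of directed edges the other way. An undirected edge counts in both directions. -/
noncomputable def crossCount (m n : ℕ) (edge : Fin (m + n) → Fin (m + n) → Prop) : ℕ :=
  {q : Fin (m + n) × Fin (m + n) | (q.1 : ℕ) < m ∧ m ≤ (q.2 : ℕ) ∧ edge q.1 q.2}.ncard +
    {q : Fin (m + n) × Fin (m + n) | (q.1 : ℕ) < m ∧ m ≤ (q.2 : ℕ) ∧ edge q.2 q.1}.ncard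

/-! Let `ν` be the mixture with density `h = p f + (1 - p) g`, and let `w = p f / h`. Sample `N`
points independently from `ν` and label each one `true` (an X-point) with probability `w` of its
position, independently. Almost surely the distances are distinct, so the greedy matching is a
function of the positions alone (`GreedyRun.unique`). Given the positions, its pairs carry
independent labels, and Hoeffding's inequality puts the number of mixed pairs near its conditional
mean, the sum of `a (1 - b) + b (1 - a)` over the pairs, where `a`, `b` are the values of `w` at the
two ends.

In a compact set only boundedly many pairs are long (`IsCompact.exists_card_long_pairs_le`). Since
`w` is close in L¹ to a uniformly continuous function, `a` and `b` nearly agree on most pairs, so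
the mean is close to the sum of `w (1 - w)` over all points (`GreedyPairs.abs_sum_sub_le`), hence to
`N ∫ w (1 - w) dν`. The failure probability is at most a constant times `exp (-2 ε² N)`
(`exists_lintegral_deviation_le`).

The true sample has exactly `m` X-points. It is the random-label model conditioned on that event, up
to a permutation that the matching does not notice. When `m / N` is near `p` the event has
probability at least `c exp (-ε² N)` (`exists_le_choose_mul_pow_mul_pow`), so conditioning keeps the
bound exponentially small, and Borel–Cantelli finishes. -/

/-! ### Greedy matchings: separation, uniqueness, measurability, symmetry. -/

/-- `P` lists the pairs of the matching `G` of the points `z k`, `k ∈ S`, each in one of its two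
orders; `sep` records that the pairs come from a greedy procedure. -/
structure GreedyPairs {ι E : Type*} [DecidableEq ι] [PseudoMetricSpace E] (z : ι → E)
    (S : Finset ι) (G : SimpleGraph ι) (P : Finset (ι × ι)) : Prop where
  left_mem : ∀ e ∈ P, e.1 ∈ S
  right_mem : ∀ e ∈ P, e.2 ∈ S
  ne : ∀ e ∈ P, e.1 ≠ e.2
  disjoint : ∀ e ∈ P, ∀ e' ∈ P, e ≠ e' → Disjoint ({e.1, e.2} : Finset ι) {e'.1, e'.2}
  adj_iff : ∀ a b, G.Adj a b ↔ (a, b) ∈ P ∨ (b, a) ∈ P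
  uncovered : (S \ P.biUnion fun e => {e.1, e.2}).card ≤ 1
  sep : ∀ e ∈ P, ∀ e' ∈ P, e ≠ e' →
    min (dist (z e.1) (z e.2)) (dist (z e'.1) (z e'.2)) ≤ dist (z e.1) (z e'.1)

/-- The number of edges of `G` from a node labelled `true` to a node labelled `false`. -/
noncomputable def labelCount {ι : Type*} (l : ι → Bool) (G : SimpleGraph ι) : ℕ :=
  {q : ι × ι | l q.1 = true ∧ l q.2 = false ∧ G.Adj q.1 q.2}.ncard

theorem labelCount_comp_equiv {ι : Type*} (l : ι → Bool) (G : SimpleGraph ι) (σ : Equiv.Perm ι) :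
    labelCount (l ∘ σ) (G.comap σ) = labelCount l G := by
  unfold labelCount
  have : {q : ι × ι | l q.1 = true ∧ l q.2 = false ∧ G.Adj q.1 q.2} =
      Prod.map σ σ '' {q : ι × ι | (l ∘ σ) q.1 = true ∧ (l ∘ σ) q.2 = false ∧
        (G.comap σ).Adj q.1 q.2} := by
    rw [← Equiv.prodCongr_apply, Equiv.image_eq_preimage_symm]
    ext q
    simp
  rw [this, Set.ncard_image_of_injective _ (σ.injective.prodMap σ.injective)]

section Greedy

variable {ι E : Type*} [DecidableEq ι]

theorem GreedyRun.exists_pairs [PseudoMetricSpace E] {z : ι → E} {S : Finset ι}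
    {G : SimpleGraph ι} (h : GreedyRun z S G) : ∃ P, GreedyPairs z S G P := by
  induction h with
  | base S hS =>
    exact ⟨∅, by simp, by simp, by simp, by simp, by simp, by simpa using hS, by simp⟩
  | pair S i j G hi hj hij hmin hG ih =>
    obtain ⟨P, hP⟩ := ih
    have h1 : ∀ e ∈ P, (e.1 ∈ S ∧ e.1 ≠ i ∧ e.1 ≠ j) ∧ (e.2 ∈ S ∧ e.2 ≠ i ∧ e.2 ≠ j) := by
      intro e he
      have a := hP.left_mem e he
      have b := hP.right_mem e he
      simp only [Finset.mem_erase] at a b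
      tauto
    -- Later pairs use points still present when `i`, `j` are matched, so the minimality of that
    -- pair gives `sep`.
    have hsep : ∀ e ∈ P, dist (z i) (z j) ≤ dist (z i) (z e.1) := fun e he =>
      hmin i hi e.1 (h1 e he).1.1 (h1 e he).1.2.1.symm
    have hdisj : ∀ e ∈ P, Disjoint ({i, j} : Finset ι) {e.1, e.2} := by
      intro e he
      have := h1 e he
      rw [Finset.disjoint_left]
      intro a
      simp only [Finset.mem_insert, Finset.mem_singleton]
      rintro (rfl | rfl) (h | h) <;> simp_all
    refine ⟨insert (i, j) P, ?_, ?_, ?_, ?_, ?_, ?_, ?_⟩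
    · simp only [Finset.mem_insert, forall_eq_or_imp]
      exact ⟨hi, fun e he => (h1 e he).1.1⟩
    · simp only [Finset.mem_insert, forall_eq_or_imp]
      exact ⟨hj, fun e he => (h1 e he).2.1⟩
    · simp only [Finset.mem_insert, forall_eq_or_imp]
      exact ⟨hij, hP.ne⟩
    · intro e he e' he' hne
      rw [Finset.mem_insert] at he he'
      rcases he with rfl | he <;> rcases he' with rfl | he'
      · exact absurd rfl hne
      · exact hdisj e' he'
      · exact (hdisj e he).symm
      · exact hP.disjoint e he e' he' hne
    · intro a b
      simp only [SimpleGraph.sup_adj, SimpleGraph.edge_adj, hP.adj_iff, Finset.mem_insert,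
        Prod.mk.injEq]
      constructor
      · rintro (⟨⟨rfl, rfl⟩ | ⟨rfl, rfl⟩, -⟩ | h | h) <;> tauto
      · rintro ((⟨rfl, rfl⟩ | h) | (⟨rfl, rfl⟩ | h))
        · exact Or.inl ⟨Or.inl ⟨rfl, rfl⟩, hij⟩
        · exact Or.inr (Or.inl h)
        · exact Or.inl ⟨Or.inr ⟨rfl, rfl⟩, hij.symm⟩
        · exact Or.inr (Or.inr h)
    · refine (Finset.card_le_card ?_).trans hP.uncovered
      intro a
      simp only [Finset.mem_sdiff, Finset.biUnion_insert, Finset.mem_union, Finset.mem_insert,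
        Finset.mem_singleton, Finset.mem_erase]
      tauto
    · intro e he e' he' hne
      rw [Finset.mem_insert] at he he'
      rcases he with rfl | he <;> rcases he' with rfl | he'
      · exact absurd rfl hne
      · exact (min_le_left _ _).trans (hsep e' he')
      · exact (min_le_right _ _).trans ((hsep e he).trans_eq (dist_comm _ _))
      · exact hP.sep e he e' he' hne

/-- The distances between the points of the family `z` determine the unordered pairs. -/
def DistinctDistances [PseudoMetricSpace E] (z : ι → E) : Prop :=
  ∀ i j k l, i ≠ j → k ≠ l → dist (z i) (z j) = dist (z k) (z l) → s(i, j) = s(k, l)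

/-- Without ties every step is forced, up to the order of the two points. The concentration bound
concerns one fixed graph, so this avoids a union over tie-breaking rules. -/
theorem GreedyRun.unique [PseudoMetricSpace E] {z : ι → E} (hz : DistinctDistances z)
    {S : Finset ι} {G G' : SimpleGraph ι} (h : GreedyRun z S G) (h' : GreedyRun z S G') :
    G = G' := by
  induction h generalizing G' with
  | base S hS =>
    cases h' with
    | base => rfl
    | pair _ i j G hi hj hij => exact absurd (Finset.card_le_one.1 hS i hi j hj) hij
  | pair S i j G hi hj hij hmin hG ih =>
    cases h' with
    | base _ hS => exact absurd (Finset.card_le_one.1 hS i hi j hj) hij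
    | pair _ k l G' hk hl hkl hmin' hG' =>
      have := hz i j k l hij hkl (le_antisymm (hmin k hk l hl hkl) (hmin' i hi j hj hij))
      rcases Sym2.eq_iff.1 this with ⟨rfl, rfl⟩ | ⟨rfl, rfl⟩
      · rw [ih hG']
      · rw [Finset.erase_right_comm] at hG'
        rw [ih hG', SimpleGraph.edge_comm]

theorem greedyRun_iff [PseudoMetricSpace E] {z : ι → E} {S : Finset ι} {G : SimpleGraph ι} :
    GreedyRun z S G ↔ (S.card ≤ 1 ∧ G = ⊥) ∨ ∃ i j G', (i ∈ S ∧ j ∈ S ∧ i ≠ j ∧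
      G = SimpleGraph.edge i j ⊔ G') ∧
      (∀ k ∈ S, ∀ l ∈ S, k ≠ l → dist (z i) (z j) ≤ dist (z k) (z l)) ∧
      GreedyRun z ((S.erase i).erase j) G' := by
  constructor
  · intro h
    cases h with
    | base _ hS => exact Or.inl ⟨hS, rfl⟩
    | pair _ i j G' hi hj hij hmin hG => exact Or.inr ⟨i, j, G', ⟨hi, hj, hij, rfl⟩, hmin, hG⟩
  · rintro (⟨hS, rfl⟩ | ⟨i, j, G', ⟨hi, hj, hij, rfl⟩, hmin, hG⟩)
    · exact .base S hS
    · exact .pair S i j G' hi hj hij hmin hG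

/-- Splitting according to the first matched pair gives a finite union of closed distance conditions
intersected with the same event for a smaller set. -/
theorem measurableSet_greedyRun [Finite ι] [PseudoMetricSpace E] [SecondCountableTopology E]
    [MeasurableSpace E] [BorelSpace E] (S : Finset ι) (G : SimpleGraph ι) :
    MeasurableSet {z : ι → E | GreedyRun z S G} := by
  induction S using Finset.strongInduction generalizing G with
  | H S ih =>
    have : {z : ι → E | GreedyRun z S G} = {z | S.card ≤ 1 ∧ G = ⊥} ∪
        ⋃ (i) (j) (G') (_ : i ∈ S ∧ j ∈ S ∧ i ≠ j ∧ G = SimpleGraph.edge i j ⊔ G'),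
          ((⋂ (k ∈ S) (l ∈ S) (_ : k ≠ l), {z | dist (z i) (z j) ≤ dist (z k) (z l)}) ∩
            {z | GreedyRun z ((S.erase i).erase j) G'}) := by
      ext z
      rw [Set.mem_ofPred_eq, greedyRun_iff]
      simp only [Set.mem_union, Set.mem_iUnion, Set.mem_inter_iff, Set.mem_iInter,
        Set.mem_ofPred_eq, exists_prop]
    rw [this]
    refine (MeasurableSet.const _).union ?_
    refine .iUnion fun i => .iUnion fun j => .iUnion fun G' => .iUnion fun h => ?_
    refine MeasurableSet.inter ?_ (ih _ ?_ G')
    · refine .biInter (Set.to_countable _) fun k _ => .biInter (Set.to_countable _) fun l _ =>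
        .iInter fun _ => ?_
      exact measurableSet_le (by fun_prop) (by fun_prop)
    · exact (Finset.erase_subset _ _).trans_ssubset (Finset.erase_ssubset h.1)

theorem GreedyRun.comp_equiv [PseudoMetricSpace E] {z : ι → E} {S : Finset ι}
    {G : SimpleGraph ι} (σ : Equiv.Perm ι) (h : GreedyRun z S G) :
    GreedyRun (z ∘ σ) (S.map σ.symm.toEmbedding) (G.comap σ) := by
  induction h with
  | base S hS => exact .base _ (by simpa using hS)
  | pair S i j G hi hj hij hmin hG ih =>
    have : (SimpleGraph.edge i j ⊔ G).comap σ =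
        SimpleGraph.edge (σ.symm i) (σ.symm j) ⊔ G.comap σ := by
      ext a b
      simp only [SimpleGraph.comap_adj, SimpleGraph.sup_adj, SimpleGraph.edge_adj,
        Equiv.eq_symm_apply, ne_eq, EmbeddingLike.apply_eq_iff_eq]
    rw [this]
    refine .pair _ _ _ _ (by simpa using hi) (by simpa using hj) (by simpa using hij) ?_ ?_
    · simp only [Finset.mem_map_equiv, Equiv.symm_symm, Function.comp_apply,
        Equiv.apply_symm_apply]
      exact fun k hk l hl hkl => hmin _ hk _ hl (by simpa using hkl)
    · rw [Finset.map_erase, Finset.map_erase] at ih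
      simpa using ih

theorem IsGreedyMatching.comp_equiv [Fintype ι] [PseudoMetricSpace E] {z : ι → E}
    {G : SimpleGraph ι} (σ : Equiv.Perm ι) (h : IsGreedyMatching z G) :
    IsGreedyMatching (z ∘ σ) (G.comap σ) := by
  simpa [IsGreedyMatching] using GreedyRun.comp_equiv σ h

theorem GreedyPairs.labelCount_eq [PseudoMetricSpace E] {z : ι → E} {S : Finset ι}
    {G : SimpleGraph ι} {P : Finset (ι × ι)} (hP : GreedyPairs z S G P) (l : ι → Bool) :
    (labelCount l G : ℝ) = ∑ e ∈ P, if l e.1 ≠ l e.2 then 1 else 0 := by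
  rw [Finset.sum_boole]
  congr 1
  have : {q : ι × ι | l q.1 = true ∧ l q.2 = false ∧ G.Adj q.1 q.2} =
      (fun e : ι × ι => if l e.1 then e else e.swap) '' {e | e ∈ P ∧ l e.1 ≠ l e.2} := by
    ext ⟨a, b⟩
    simp only [Set.mem_ofPred_eq, Set.mem_image, hP.adj_iff, Prod.exists]
    constructor
    · rintro ⟨ha, hb, h | h⟩
      · exact ⟨a, b, ⟨h, by simp [ha, hb]⟩, by simp [ha]⟩
      · exact ⟨b, a, ⟨h, by simp [ha, hb]⟩, by simp [hb]⟩
    · rintro ⟨c, d, ⟨h, hl⟩, he⟩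
      cases hc : l c <;> simp_all
  rw [labelCount, this, Set.InjOn.ncard_image, ← Set.ncard_coe_finset]
  · simp
  · rintro ⟨a, b⟩ ⟨h, hl⟩ ⟨a', b'⟩ ⟨h', hl'⟩ heq
    by_contra hne
    have hd := Finset.disjoint_left.1 (hP.disjoint _ h _ h' hne)
    have h1 := hd (Finset.mem_insert_self _ _)
    have h2 := hd (Finset.mem_insert_of_mem (Finset.mem_singleton_self _))
    simp only [Finset.mem_insert, Finset.mem_singleton] at h1 h2
    dsimp only at heq
    split_ifs at heq <;> simp_all

theorem GreedyPairs.sum_covered [PseudoMetricSpace E] {z : ι → E} {S : Finset ι}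
    {G : SimpleGraph ι} {P : Finset (ι × ι)} (hP : GreedyPairs z S G P) (v : ι → ℝ) :
    ∑ i ∈ P.biUnion (fun e => {e.1, e.2}), v i = ∑ e ∈ P, (v e.1 + v e.2) := by
  rw [Finset.sum_biUnion fun e he e' he' hne => hP.disjoint e he e' he' hne]
  exact Finset.sum_congr rfl fun e he => Finset.sum_pair (hP.ne e he)

theorem GreedyPairs.two_mul_card_le [Fintype ι] [PseudoMetricSpace E] {z : ι → E} {S : Finset ι}
    {G : SimpleGraph ι} {P : Finset (ι × ι)} (hP : GreedyPairs z S G P) :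
    2 * (P.card : ℝ) ≤ Fintype.card ι := by
  have h := hP.sum_covered fun _ => 1
  rw [Finset.sum_const, Finset.sum_const] at h
  have h2 : ((P.biUnion fun e => ({e.1, e.2} : Finset ι)).card : ℝ) ≤ Fintype.card ι := by
    exact_mod_cast Finset.card_le_univ _
  simp only [nsmul_eq_mul, mul_one] at h
  linarith

/-- If labels are independent and the node `i` is labelled `true` with probability `a i`, then
the expected number of pairs with different labels is close to `∑ a i (1 - a i)`, provided that
most pairs are shorter than `r` and `a` varies little over such distances. -/
theorem GreedyPairs.abs_sum_sub_le [Fintype ι] [PseudoMetricSpace E] {z : ι → E}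
    {G : SimpleGraph ι} {P : Finset (ι × ι)} (hP : GreedyPairs z Finset.univ G P)
    {a v : ι → ℝ} (ha : ∀ i, a i ∈ Set.Icc 0 1) (hv : ∀ i, 0 ≤ v i) {r δ : ℝ} (hδ : 0 ≤ δ)
    (hav : ∀ i j, dist (z i) (z j) < r → |a i - a j| ≤ v i + v j + δ) {C : ℕ}
    (hC : (P.filter fun e => r ≤ dist (z e.1) (z e.2)).card ≤ C) :
    |∑ e ∈ P, (a e.1 * (1 - a e.2) + a e.2 * (1 - a e.1)) - ∑ i, a i * (1 - a i)| ≤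
      ∑ i, v i + δ * Fintype.card ι + C + 1 := by
  set U := P.biUnion fun e => ({e.1, e.2} : Finset ι) with hU
  have hsplit : ∑ i, a i * (1 - a i) = ∑ i ∈ Finset.univ \ U, a i * (1 - a i) +
      ∑ e ∈ P, (a e.1 * (1 - a e.1) + a e.2 * (1 - a e.2)) := by
    rw [← hP.sum_covered fun i => a i * (1 - a i)]
    exact (Finset.sum_sdiff (Finset.subset_univ U)).symm
  -- Replacing the mixed products by the pointwise variances costs exactly the squared differences,
  -- which are small on short pairs.
  have hdiff : ∑ e ∈ P, (a e.1 * (1 - a e.2) + a e.2 * (1 - a e.1)) -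
      ∑ e ∈ P, (a e.1 * (1 - a e.1) + a e.2 * (1 - a e.2)) = ∑ e ∈ P, (a e.1 - a e.2) ^ 2 := by
    rw [← Finset.sum_sub_distrib]
    exact Finset.sum_congr rfl fun e _ => by ring
  have h01 : ∀ i, 0 ≤ a i * (1 - a i) ∧ a i * (1 - a i) ≤ 1 := fun i =>
    ⟨mul_nonneg (ha i).1 (by linarith [(ha i).2]), by nlinarith [(ha i).1, (ha i).2]⟩
  have hunc0 : 0 ≤ ∑ i ∈ Finset.univ \ U, a i * (1 - a i) :=
    Finset.sum_nonneg fun i _ => (h01 i).1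
  have hunc1 : ∑ i ∈ Finset.univ \ U, a i * (1 - a i) ≤ 1 := by
    refine (Finset.sum_le_card_nsmul _ _ 1 fun i _ => (h01 i).2).trans ?_
    have := hP.uncovered
    rw [← hU] at this
    simpa using this
  have hsq0 : 0 ≤ ∑ e ∈ P, (a e.1 - a e.2) ^ 2 := Finset.sum_nonneg fun e _ => sq_nonneg _
  -- A squared difference is at most the absolute difference, which `hav` controls on short pairs,
  -- and never exceeds 1, so the long pairs cost at most `C`.
  have hsq1 : ∑ e ∈ P, (a e.1 - a e.2) ^ 2 ≤ ∑ i, v i + δ * Fintype.card ι + C := by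
    have hpt : ∀ e ∈ P, (a e.1 - a e.2) ^ 2 ≤
        (v e.1 + v e.2) + δ + if r ≤ dist (z e.1) (z e.2) then 1 else 0 := by
      intro e _
      have hle : |a e.1 - a e.2| ≤ 1 := by
        rw [abs_le]
        constructor <;> linarith [(ha e.1).1, (ha e.2).1, (ha e.1).2, (ha e.2).2]
      have hsq : (a e.1 - a e.2) ^ 2 ≤ |a e.1 - a e.2| := by
        rw [← sq_abs]
        nlinarith [abs_nonneg (a e.1 - a e.2)]
      split_ifs with h
      · linarith [hv e.1, hv e.2]
      · linarith [hav _ _ (not_le.1 h)]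
    refine (Finset.sum_le_sum hpt).trans ?_
    rw [Finset.sum_add_distrib, Finset.sum_add_distrib, ← hP.sum_covered, Finset.sum_boole,
      Finset.sum_const, nsmul_eq_mul, mul_comm _ δ]
    have h1 : ∑ i ∈ U, v i ≤ ∑ i, v i :=
      Finset.sum_le_univ_sum_of_nonneg hv
    have h2 : δ * P.card ≤ δ * Fintype.card ι :=
      mul_le_mul_of_nonneg_left (by linarith [hP.two_mul_card_le, P.card.cast_nonneg (α := ℝ)]) hδ
    have h3 : ((P.filter fun e => r ≤ dist (z e.1) (z e.2)).card : ℝ) ≤ C := by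
      exact_mod_cast hC
    linarith
  rw [hsplit, abs_le]
  constructor <;> linarith

end Greedy

/-- In a compact set, the number of long pairs of a greedy matching is bounded. -/
theorem IsCompact.exists_card_long_pairs_le {E : Type*} [PseudoMetricSpace E] {K : Set E}
    (hK : IsCompact K) {r : ℝ} (hr : 0 < r) : ∃ C : ℕ, ∀ (N : ℕ) (z : Fin N → E)
      (S : Finset (Fin N)) (G : SimpleGraph (Fin N)) (P : Finset (Fin N × Fin N)),
      (∀ i, z i ∈ K) → GreedyPairs z S G P →
        (P.filter fun e => r ≤ dist (z e.1) (z e.2)).card ≤ C := by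
  obtain ⟨t, -, ht, hcov⟩ := hK.finite_cover_balls (half_pos hr)
  refine ⟨ht.toFinset.card, fun N z S G P hz hP => ?_⟩
  have : ∀ i, ∃ c ∈ t, dist (z i) c < r / 2 := fun i => by simpa using hcov (hz i)
  choose c hct hc using this
  -- First endpoints of distinct long pairs are at distance at least `r` by `sep`, so no ball of
  -- radius `r / 2` contains two of them.
  refine Finset.card_le_card_of_injOn (fun e => c e.1) (fun e _ => by simpa using hct e.1) ?_
  intro e he e' he' heq
  by_contra hne
  simp only [Finset.coe_filter, Set.mem_ofPred_eq] at he he'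
  have h1 := hP.sep e he.1 e' he'.1 hne
  have h2 : r ≤ dist (z e.1) (z e'.1) := (le_min he.2 he'.2).trans h1
  have h3 := dist_triangle_right (z e.1) (z e'.1) (c e.1)
  have h4 := hc e'.1
  simp only at heq
  rw [← heq] at h4
  linarith [hc e.1]

/-! ### Hoeffding bounds for samples and for random labels. -/

section Concentration

theorem ProbabilityTheory.HasSubgaussianMGF.mono_const {Ω : Type*} {mΩ : MeasurableSpace Ω}
    {μ : Measure Ω} {X : Ω → ℝ} {c c' : NNReal} (h : HasSubgaussianMGF X c μ) (hc : c ≤ c') :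
    HasSubgaussianMGF X c' μ where
  integrable_exp_mul := h.integrable_exp_mul
  mgf_le t := (h.mgf_le t).trans <| by gcongr

theorem ProbabilityTheory.HasSubgaussianMGF.measure_le_abs {Ω : Type*} {mΩ : MeasurableSpace Ω}
    {μ : Measure Ω} [IsFiniteMeasure μ] {X : Ω → ℝ} {k N : ℕ}
    (h : HasSubgaussianMGF X (k * (1 / 4)) μ) (hk : k ≤ N) {t : ℝ} (ht : 0 ≤ t) :
    μ {ω | t * N ≤ |X ω|} ≤ ENNReal.ofReal (2 * Real.exp (-(2 * t ^ 2) * N)) := by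
  have h' : HasSubgaussianMGF X (N * (1 / 4)) μ := h.mono_const (by gcongr)
  have htN : 0 ≤ t * N := by positivity
  have hexp : -(t * N) ^ 2 / (2 * ((N * (1 / 4) : NNReal) : ℝ)) = -(2 * t ^ 2) * N := by
    rcases eq_or_ne N 0 with rfl | hN
    · simp
    · push_cast
      field_simp
      ring
  have h1 := h'.measure_ge_le htN
  have h2 := h'.neg.measure_ge_le htN
  rw [hexp] at h1 h2
  have hsub : {ω | t * N ≤ |X ω|} ⊆ {ω | t * N ≤ X ω} ∪ {ω | t * N ≤ (-X) ω} := by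
    intro ω hω
    exact le_abs.1 (show t * N ≤ |X ω| from hω)
  have h3 := (measureReal_mono hsub (measure_ne_top μ _)).trans
    ((measureReal_union_le _ _).trans (add_le_add h1 h2))
  rw [← two_mul] at h3
  exact ENNReal.le_ofReal_iff_toReal_le (measure_ne_top μ _) (by positivity) |>.2 h3

theorem hasSubgaussianMGF_of_mem_unitInterval {Ω : Type*} {mΩ : MeasurableSpace Ω}
    {μ : Measure Ω} [IsProbabilityMeasure μ] {X : Ω → ℝ} (hX : Measurable X)
    (h : ∀ ω, X ω ∈ Set.Icc 0 1) : HasSubgaussianMGF (fun ω => X ω - ∫ ω, X ω ∂μ) (1 / 4) μ := by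
  have := hasSubgaussianMGF_of_mem_Icc (μ := μ) hX.aemeasurable (ae_of_all _ h)
  convert this using 1
  norm_num

/-- **Hoeffding's inequality** for a function of an IID sample, two-sided. -/
theorem measure_pi_abs_sum_sub_ge_le {E : Type*} [MeasurableSpace E] (ν : Measure E)
    [IsProbabilityMeasure ν] {v : E → ℝ} (hv : Measurable v) (h01 : ∀ x, v x ∈ Set.Icc 0 1)
    (N : ℕ) {t : ℝ} (ht : 0 ≤ t) :
    Measure.pi (fun _ : Fin N => ν) {z | t * N ≤ |∑ i, v (z i) - N * ∫ x, v x ∂ν|} ≤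
      ENNReal.ofReal (2 * Real.exp (-(2 * t ^ 2) * N)) := by
  have hind : iIndepFun (fun (i : Fin N) (z : Fin N → E) => v (z i) - ∫ x, v x ∂ν)
      (Measure.pi fun _ => ν) :=
    iIndepFun_pi (X := fun (_ : Fin N) x => v x - ∫ x, v x ∂ν)
      fun i => (hv.sub_const _).aemeasurable
  have hsub : ∀ i ∈ (Finset.univ : Finset (Fin N)),
      HasSubgaussianMGF (fun z : Fin N → E => v (z i) - ∫ x, v x ∂ν) (1 / 4)
        (Measure.pi fun _ => ν) := by
    intro i _
    have := hasSubgaussianMGF_of_mem_unitInterval (μ := Measure.pi fun _ : Fin N => ν)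
      (X := fun z => v (z i)) (hv.comp (measurable_pi_apply i)) fun z => h01 _
    rwa [integral_comp_eval (μ := fun _ : Fin N => ν) hv.aestronglyMeasurable] at this
  have h := HasSubgaussianMGF.sum_of_iIndepFun hind hsub
  rw [Finset.sum_const, Finset.card_univ, Fintype.card_fin, nsmul_eq_mul] at h
  have := h.measure_le_abs le_rfl ht
  simpa [Finset.sum_sub_distrib] using this

/-- The law of a label that is `true` with probability `a`. -/
noncomputable def labelMeasure (a : ℝ) : Measure Bool :=
  ENNReal.ofReal a • Measure.dirac true + ENNReal.ofReal (1 - a) • Measure.dirac false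

theorem isProbabilityMeasure_labelMeasure {a : ℝ} (ha : a ∈ Set.Icc 0 1) :
    IsProbabilityMeasure (labelMeasure a) := by
  constructor
  simp only [labelMeasure, Measure.add_apply, Measure.smul_apply, measure_univ, smul_eq_mul,
    mul_one]
  rw [← ENNReal.ofReal_add ha.1 (by linarith [ha.2])]
  simp

theorem labelMeasure_singleton (a : ℝ) (b : Bool) :
    labelMeasure a {b} = if b then ENNReal.ofReal a else ENNReal.ofReal (1 - a) := by
  cases b <;> simp [labelMeasure]

theorem integral_labelMeasure {a : ℝ} (ha : a ∈ Set.Icc 0 1) :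
    ∫ b, (if b then (1 : ℝ) else 0) ∂labelMeasure a = a := by
  have := isProbabilityMeasure_labelMeasure ha
  rw [integral_fintype (Integrable.of_finite)]
  simp [measureReal_def, labelMeasure_singleton, ha.1]

variable {ι : Type*} [Fintype ι] {a : ι → ℝ}

theorem integral_label_ne (ha : ∀ i, a i ∈ Set.Icc 0 1) {i j : ι} (hij : i ≠ j) :
    ∫ l : ι → Bool, (if l i ≠ l j then (1 : ℝ) else 0) ∂Measure.pi (fun i => labelMeasure (a i)) =
      a i * (1 - a j) + a j * (1 - a i) := by
  have hp := fun i => isProbabilityMeasure_labelMeasure (ha i)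
  let B : Bool → ℝ := fun b => if b then 1 else 0
  have hB : Measurable B := measurable_of_countable _
  have hint : ∀ k, ∫ l : ι → Bool, B (l k) ∂Measure.pi (fun i => labelMeasure (a i)) = a k := by
    intro k
    rw [integral_comp_eval (μ := fun i => labelMeasure (a i)) hB.aestronglyMeasurable]
    exact integral_labelMeasure (ha k)
  have hind : iIndepFun (fun (i : ι) (l : ι → Bool) => B (l i))
      (Measure.pi fun i => labelMeasure (a i)) :=
    iIndepFun_pi (X := fun (_ : ι) => B) fun i => hB.aemeasurable
  have hmul := (hind.indepFun hij).integral_fun_mul_eq_mul_integral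
    (hB.comp (measurable_pi_apply i)).aestronglyMeasurable
    (hB.comp (measurable_pi_apply j)).aestronglyMeasurable
  rw [hint, hint] at hmul
  have hpt : ∀ l : ι → Bool, (if l i ≠ l j then (1 : ℝ) else 0) =
      B (l i) + B (l j) - 2 * (B (l i) * B (l j)) := by
    intro l
    cases l i <;> cases l j <;> norm_num [B]
  simp_rw [hpt]
  rw [integral_sub .of_finite .of_finite, integral_add .of_finite .of_finite, integral_const_mul,
    hint, hint, hmul]
  ring

variable [DecidableEq ι]

/-- The pairs are disjoint, so the term of a new pair depends on labels independent of all earlier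
ones, and sub-Gaussian parameters add. Each indicator lies in `[0, 1]` and contributes `1 / 4`. -/
theorem hasSubgaussianMGF_sum_label_ne (ha : ∀ i, a i ∈ Set.Icc 0 1) (P : Finset (ι × ι))
    (hne : ∀ e ∈ P, e.1 ≠ e.2)
    (hdisj : ∀ e ∈ P, ∀ e' ∈ P, e ≠ e' → Disjoint ({e.1, e.2} : Finset ι) {e'.1, e'.2}) :
    HasSubgaussianMGF (fun l : ι → Bool => ∑ e ∈ P, ((if l e.1 ≠ l e.2 then (1 : ℝ) else 0) -
      (a e.1 * (1 - a e.2) + a e.2 * (1 - a e.1)))) (P.card * (1 / 4))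
      (Measure.pi fun i => labelMeasure (a i)) := by
  have hp := fun i => isProbabilityMeasure_labelMeasure (ha i)
  induction P using Finset.induction_on with
  | empty => simp
  | insert e P he ih =>
    have ih' := ih (fun e' h => hne e' (Finset.mem_insert_of_mem h)) fun e' h' e'' h'' =>
      hdisj e' (Finset.mem_insert_of_mem h') e'' (Finset.mem_insert_of_mem h'')
    have h1 := hasSubgaussianMGF_of_mem_unitInterval (μ := Measure.pi fun i => labelMeasure (a i))
      (X := fun l : ι → Bool => if l e.1 ≠ l e.2 then (1 : ℝ) else 0) (measurable_of_countable _)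
      fun l => by split_ifs <;> simp
    rw [integral_label_ne ha (hne e (Finset.mem_insert_self _ _))] at h1
    have hdis : Disjoint ({e.1, e.2} : Finset ι) (P.biUnion fun e => {e.1, e.2}) := by
      rw [Finset.disjoint_biUnion_right]
      intro e' he'
      exact hdisj e (Finset.mem_insert_self _ _) e' (Finset.mem_insert_of_mem he')
        fun h => he (h ▸ he')
    have hind : iIndepFun (fun (i : ι) (l : ι → Bool) => l i)
        (Measure.pi fun i => labelMeasure (a i)) :=
      iIndepFun_pi (X := fun (_ : ι) => id) fun i => aemeasurable_id
    have hfin := hind.indepFun_finset _ _ hdis fun i => measurable_pi_apply i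
    let φ : ({x // x ∈ ({e.1, e.2} : Finset ι)} → Bool) → ℝ := fun l =>
      (if l ⟨e.1, by simp⟩ ≠ l ⟨e.2, by simp⟩ then (1 : ℝ) else 0) -
        (a e.1 * (1 - a e.2) + a e.2 * (1 - a e.1))
    let ψ : ({x // x ∈ P.biUnion fun e => ({e.1, e.2} : Finset ι)} → Bool) → ℝ := fun l =>
      ∑ e : P, ((if l ⟨e.1.1, Finset.mem_biUnion.2 ⟨e, e.2, by simp⟩⟩ ≠
        l ⟨e.1.2, Finset.mem_biUnion.2 ⟨e, e.2, by simp⟩⟩ then (1 : ℝ) else 0) -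
        (a e.1.1 * (1 - a e.1.2) + a e.1.2 * (1 - a e.1.1)))
    have hcomp := hfin.comp (φ := φ) (ψ := ψ) (measurable_of_countable _)
      (measurable_of_countable _)
    have hψ : (ψ ∘ fun (l : ι → Bool) (i : {x // x ∈ P.biUnion fun e => ({e.1, e.2} : Finset ι)}) =>
        l i) = fun l : ι → Bool => ∑ e ∈ P, ((if l e.1 ≠ l e.2 then (1 : ℝ) else 0) -
          (a e.1 * (1 - a e.2) + a e.2 * (1 - a e.1))) := by
      funext l
      exact Finset.sum_coe_sort P fun e => ((if l e.1 ≠ l e.2 then (1 : ℝ) else 0) -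
          (a e.1 * (1 - a e.2) + a e.2 * (1 - a e.1)))
    rw [hψ] at hcomp
    have := h1.add_of_indepFun ih' hcomp
    simp_rw [Finset.sum_insert he]
    convert this using 1
    rw [Finset.card_insert_of_notMem he]
    push_cast
    ring

theorem GreedyPairs.measure_labelCount_le {E : Type*} [PseudoMetricSpace E] {z : ι → E}
    {S : Finset ι} {G : SimpleGraph ι} {P : Finset (ι × ι)} (hP : GreedyPairs z S G P)
    (ha : ∀ i, a i ∈ Set.Icc 0 1) {t : ℝ} (ht : 0 ≤ t) :
    (Measure.pi fun i => labelMeasure (a i)) {l | t * Fintype.card ι ≤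
      |(labelCount l G : ℝ) - ∑ e ∈ P, (a e.1 * (1 - a e.2) + a e.2 * (1 - a e.1))|} ≤
      ENNReal.ofReal (2 * Real.exp (-(2 * t ^ 2) * Fintype.card ι)) := by
  have hp := fun i => isProbabilityMeasure_labelMeasure (ha i)
  have hcard : P.card ≤ Fintype.card ι := by
    have := hP.two_mul_card_le
    have h0 := P.card.cast_nonneg (α := ℝ)
    exact_mod_cast (by linarith : (P.card : ℝ) ≤ Fintype.card ι)
  have := (hasSubgaussianMGF_sum_label_ne ha P hP.ne hP.disjoint).measure_le_abs hcard ht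
  simp_rw [hP.labelCount_eq, ← Finset.sum_sub_distrib]
  exact this

end Concentration

/-! ### Densities and permutations of product measures. -/

section ProductMeasure

variable {ι E : Type*} [Fintype ι] [MeasurableSpace E]

theorem lintegral_pi_prod_eq_prod_lintegral (ν : ι → Measure E) [∀ i, IsProbabilityMeasure (ν i)]
    {u : ι → E → ENNReal} (hu : ∀ i, Measurable (u i)) :
    ∫⁻ z, ∏ i, u i (z i) ∂Measure.pi ν = ∏ i, ∫⁻ x, u i x ∂ν i := by
  have hind := iIndepFun_pi (μ := ν) (X := u) fun i => (hu i).aemeasurable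
  rw [lintegral_prod_eq_prod_lintegral_of_indepFun Finset.univ _ hind
    fun i => (hu i).comp (measurable_pi_apply i)]
  exact Finset.prod_congr rfl fun i _ => (measurePreserving_eval ν i).lintegral_comp (hu i)

/-- The product of measures which, up to constants `c i`, have densities `u i` with respect to
`ν i` has, up to the constant `∏ c i`, the product density. -/
theorem prod_smul_pi_eq_withDensity (ν κ : ι → Measure E) [∀ i, IsProbabilityMeasure (ν i)]
    [∀ i, IsProbabilityMeasure (κ i)] {c : ι → ENNReal} (hc : ∀ i, c i ≠ ⊤)
    {u : ι → E → ENNReal} (hu : ∀ i, Measurable (u i))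
    (h : ∀ i, c i • κ i = (ν i).withDensity (u i)) :
    (∏ i, c i) • Measure.pi κ = (Measure.pi ν).withDensity fun z => ∏ i, u i (z i) := by
  have hfin : ∀ i, IsFiniteMeasure (c i • κ i) := fun i => (κ i).smul_finite (hc i)
  have h1 : Measure.pi (fun i => c i • κ i) = (∏ i, c i) • Measure.pi κ := by
    refine Measure.pi_eq fun s hs => ?_
    simp [Finset.prod_mul_distrib]
  have h2 : Measure.pi (fun i => c i • κ i) =
      (Measure.pi ν).withDensity fun z => ∏ i, u i (z i) := by
    refine Measure.pi_eq fun s hs => ?_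
    have hbox : MeasurableSet (Set.univ.pi s) := MeasurableSet.univ_pi hs
    rw [withDensity_apply _ hbox, ← lintegral_indicator hbox]
    have : ∀ z : ι → E, (Set.univ.pi s).indicator (fun z => ∏ i, u i (z i)) z =
        ∏ i, (s i).indicator (u i) (z i) := by
      intro z
      by_cases hz : z ∈ Set.univ.pi s
      · rw [Set.indicator_of_mem hz]
        exact Finset.prod_congr rfl fun i _ =>
          (Set.indicator_of_mem (hz i (Set.mem_univ i)) _).symm
      · rw [Set.indicator_of_notMem hz]
        obtain ⟨i, hi⟩ : ∃ i, z i ∉ s i := by simpa using hz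
        exact (Finset.prod_eq_zero (Finset.mem_univ i) (Set.indicator_of_notMem hi _)).symm
    simp_rw [this]
    rw [lintegral_pi_prod_eq_prod_lintegral ν fun i => (hu i).indicator (hs i)]
    refine Finset.prod_congr rfl fun i _ => ?_
    rw [lintegral_indicator (hs i), h i, withDensity_apply _ (hs i)]
  rw [← h1, h2]

theorem map_pi_comp_perm (κ : ι → Measure E) [∀ i, SigmaFinite (κ i)] (σ : Equiv.Perm ι) :
    (Measure.pi κ).map (fun z => z ∘ σ) = Measure.pi fun i => κ (σ i) := by
  refine (Measure.pi_eq fun s hs => ?_).symm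
  rw [Measure.map_apply (by fun_prop) (MeasurableSet.univ_pi hs)]
  have : (fun z : ι → E => z ∘ σ) ⁻¹' Set.univ.pi s = Set.univ.pi fun i => s (σ.symm i) := by
    ext z
    simp only [Set.mem_preimage, Set.mem_univ_pi, Function.comp_apply]
    exact ⟨fun h i => by simpa using h (σ.symm i), fun h i => by simpa using h (σ i)⟩
  rw [this, Measure.pi_pi, ← Equiv.prod_comp σ]
  simp

end ProductMeasure

/-! ### Almost sure absence of ties. -/

section DistinctDistances

variable {ι E : Type*} [Fintype ι] [PseudoMetricSpace E] [SecondCountableTopology E]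
  [MeasurableSpace E] [BorelSpace E]

/-- With the other three points fixed, equality would put `z i` on a sphere around `z j`, a null
set. Coincidences among `j`, `k`, `l` do no harm. -/
theorem ae_pi_dist_ne (ν : Measure E) [IsProbabilityMeasure ν]
    (hν : ∀ x r, ν (Metric.sphere x r) = 0) {i j k l : ι} (hj : j ≠ i) (hk : k ≠ i) (hl : l ≠ i) :
    ∀ᵐ z ∂Measure.pi (fun _ : ι => ν), dist (z i) (z j) ≠ dist (z k) (z l) := by
  classical
  set Q := Measure.pi (fun _ : ι => ν)
  have hind : iIndepFun (fun (i : ι) (z : ι → E) => z i) Q :=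
    iIndepFun_pi (X := fun (_ : ι) => id) fun i => aemeasurable_id
  have hdis : Disjoint ({j, k, l} : Finset ι) {i} := by simp [hj.symm, hk.symm, hl.symm]
  have hfin := hind.indepFun_finset _ _ hdis fun i => measurable_pi_apply i
  have hcomp : IndepFun (fun z : ι → E => (z j, z k, z l)) (fun z => z i) Q :=
    hfin.comp
      (φ := fun z : {x // x ∈ ({j, k, l} : Finset ι)} → E =>
        (z ⟨j, by simp⟩, z ⟨k, by simp⟩, z ⟨l, by simp⟩))
      (ψ := fun z : {x // x ∈ ({i} : Finset ι)} → E => z ⟨i, by simp⟩) (by fun_prop) (by fun_prop)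
  rw [indepFun_iff_map_prod_eq_prod_map_map (by fun_prop)
    (measurable_pi_apply i).aemeasurable] at hcomp
  have hset : MeasurableSet {q : (E × E × E) × E | dist q.2 q.1.1 = dist q.1.2.1 q.1.2.2} :=
    measurableSet_eq_fun (by fun_prop) (by fun_prop)
  rw [ae_iff]
  have hnull : (Q.map fun z => ((z j, z k, z l), z i))
      {q : (E × E × E) × E | dist q.2 q.1.1 = dist q.1.2.1 q.1.2.2} = 0 := by
    have hi : Q.map (fun z => z i) = ν := (measurePreserving_eval (fun _ : ι => ν) i).map_eq
    rw [hcomp, hi, Measure.measure_prod_null hset]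
    exact ae_of_all _ fun q => hν q.1 (dist q.2.1 q.2.2)
  rw [Measure.map_apply (by fun_prop) hset] at hnull
  simpa using hnull

theorem ae_pi_distinctDistances (ν : Measure E) [IsProbabilityMeasure ν]
    (hν : ∀ x r, ν (Metric.sphere x r) = 0) :
    ∀ᵐ z ∂Measure.pi (fun _ : ι => ν), DistinctDistances z := by
  have h : ∀ᵐ z ∂Measure.pi (fun _ : ι => ν), ∀ i j k l : ι, j ≠ i → k ≠ i → l ≠ i →
      dist (z i) (z j) ≠ dist (z k) (z l) := by
    simp_rw [ae_all_iff]
    exact fun i j k l hj hk hl => ae_pi_dist_ne ν hν hj hk hl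
  filter_upwards [h] with z hz i j k l hij hkl heq
  by_contra hne
  rw [Sym2.eq_iff] at hne
  -- Two different unordered pairs leave `i` or `j` outside `{k, l}`; that point plays the role of
  -- the free one.
  by_cases hi : k ≠ i ∧ l ≠ i
  · exact hz i j k l hij.symm hi.1 hi.2 heq
  · have hj : k ≠ j ∧ l ≠ j := by
      constructor <;> rintro rfl <;> apply hi <;> constructor <;> rintro rfl <;> simp_all
    exact hz j i k l hij hj.1 hj.2 (by rwa [dist_comm])

end DistinctDistances

/-! ### From fixed labels to random labels. -/

section Deviation

variable {ι E : Type*} [Fintype ι] [DecidableEq ι] [PseudoMetricSpace E]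

/-- The positions of points, labelled by `l`, for which some greedy matching has a number of
pairs with different labels that differs from `c` by at least `t`. -/
def deviationSet (E : Type*) [PseudoMetricSpace E] (l : ι → Bool) (t c : ℝ) : Set (ι → E) :=
  {z | ∃ G, IsGreedyMatching z G ∧ t ≤ |(labelCount l G : ℝ) - c|}

theorem measurableSet_deviationSet [SecondCountableTopology E] [MeasurableSpace E] [BorelSpace E]
    (l : ι → Bool) (t c : ℝ) : MeasurableSet (deviationSet E l t c) := by
  have : deviationSet E l t c = ⋃ (G : SimpleGraph ι) (_ : t ≤ |(labelCount l G : ℝ) - c|),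
      {z | GreedyRun z Finset.univ G} := by
    ext z
    simp only [deviationSet, IsGreedyMatching, Set.mem_ofPred_eq, Set.mem_iUnion, exists_prop,
      and_comm]
  rw [this]
  exact .iUnion fun G => .iUnion fun _ => measurableSet_greedyRun _ _

/-- A permutation carries one labelling to the other, and greedy matchings are equivariant under it.
-/
theorem measure_deviationSet_le_of_card_eq [SecondCountableTopology E] [MeasurableSpace E]
    [BorelSpace E] (κ : Bool → Measure E) [∀ b, IsProbabilityMeasure (κ b)] {l l' : ι → Bool}
    (h : Fintype.card {i // l i = true} = Fintype.card {i // l' i = true}) (t c : ℝ) :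
    Measure.pi (fun i => κ (l i)) (deviationSet E l t c) ≤
      Measure.pi (fun i => κ (l' i)) (deviationSet E l' t c) := by
  let e : {i // l' i = true} ≃ {i // l i = true} := Fintype.equivOfCardEq h.symm
  let σ : Equiv.Perm ι := e.extendSubtype
  have hσ : l' = l ∘ σ := by
    funext i
    by_cases hi : l' i = true
    · rw [hi, Function.comp_apply, e.extendSubtype_mem i hi]
    · rw [Function.comp_apply, Bool.eq_false_of_not_eq_true hi,
        Bool.eq_false_of_not_eq_true (e.extendSubtype_not_mem i hi)]
  rw [hσ]
  have := map_pi_comp_perm (fun i => κ (l i)) σ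
  simp only [Function.comp_apply]
  rw [← this, Measure.map_apply (by fun_prop) (measurableSet_deviationSet _ _ _)]
  refine measure_mono ?_
  rintro z ⟨G, hG, hd⟩
  exact ⟨G.comap σ, hG.comp_equiv σ, by rwa [labelCount_comp_equiv]⟩

/-- Bayes' rule: labels may be drawn first and positions given labels, or positions first from `ν`
and labels given positions. Hypothesis `hκ` says that both orders give one label and its position
the same joint law. -/
theorem sum_prod_mul_measure_eq_lintegral [SecondCountableTopology E] [MeasurableSpace E]
    [BorelSpace E] (ν : Measure E) [IsProbabilityMeasure ν] (κ : Bool → Measure E)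
    [∀ b, IsProbabilityMeasure (κ b)] {w : E → ℝ} (hw : Measurable w)
    (hw01 : ∀ x, w x ∈ Set.Icc 0 1) {q : Bool → ENNReal} (hq : ∀ b, q b ≠ ⊤)
    (hκ : ∀ b, q b • κ b = ν.withDensity fun x => labelMeasure (w x) {b}) (t c : ℝ) :
    ∑ l : ι → Bool, (∏ i, q (l i)) * Measure.pi (fun i => κ (l i)) (deviationSet E l t c) =
      ∫⁻ z, (Measure.pi fun i => labelMeasure (w (z i))) {l | z ∈ deviationSet E l t c}
        ∂Measure.pi fun _ : ι => ν := by
  have hmeas : ∀ b, Measurable fun x => labelMeasure (w x) {b} := by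
    intro b
    simp_rw [labelMeasure_singleton]
    cases b
    · simpa using (measurable_const.sub hw).ennreal_ofReal
    · simpa using hw.ennreal_ofReal
  have hp := fun x => isProbabilityMeasure_labelMeasure (hw01 x)
  have hterm : ∀ l : ι → Bool,
      (∏ i, q (l i)) * Measure.pi (fun i => κ (l i)) (deviationSet E l t c) =
      ∫⁻ z, (deviationSet E l t c).indicator
        (fun z => ∏ i, labelMeasure (w (z i)) {l i}) z ∂Measure.pi fun _ : ι => ν := by
    intro l
    have := prod_smul_pi_eq_withDensity (fun _ : ι => ν) (fun i => κ (l i))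
      (c := fun i => q (l i)) (u := fun i x => labelMeasure (w x) {l i})
      (fun i => hq _) (fun i => hmeas _) (fun i => hκ _)
    rw [lintegral_indicator (measurableSet_deviationSet _ _ _),
      ← withDensity_apply _ (measurableSet_deviationSet _ _ _), ← this]
    rfl
  simp_rw [hterm]
  rw [← lintegral_finsetSum]
  · refine lintegral_congr fun z => ?_
    classical
    have hfin : {l : ι → Bool | z ∈ deviationSet E l t c} =
        ((Finset.univ.filter fun l : ι → Bool => z ∈ deviationSet E l t c : Finset (ι → Bool)) :
          Set (ι → Bool)) := by
      ext l
      simp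
    rw [hfin, ← sum_measure_singleton, Finset.sum_filter]
    refine Finset.sum_congr rfl fun l _ => ?_
    rw [Measure.pi_singleton, Set.indicator_apply]
  · intro l _
    exact (Finset.measurable_prod _ fun i _ => (hmeas _).comp (measurable_pi_apply i)).indicator
      (measurableSet_deviationSet _ _ _)

end Deviation

/-! ### Deviation bound under random labels. -/

section SumBound

variable {E : Type*} [MetricSpace E] [ProperSpace E] [SecondCountableTopology E]
  [MeasurableSpace E] [BorelSpace E]

/-- If the points `z i` are typical for `ν` and independent labels are `true` with
probability `w (z i)`, then the number of pairs with different labels is close to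
`N ∫ w (1 - w) dν`, except with exponentially small probability. -/
theorem exists_lintegral_deviation_le (ν : Measure E) [IsProbabilityMeasure ν]
    (hν : ∀ x r, ν (Metric.sphere x r) = 0) {K : Set E} (hK : IsCompact K) (hνK : ∀ᵐ x ∂ν, x ∈ K)
    {w : E → ℝ} (hw : Measurable w) (hw01 : ∀ x, w x ∈ Set.Icc 0 1) {ε : ℝ} (hε : 0 < ε) :
    ∃ N₀ : ℕ, ∀ N ≥ N₀,
      ∫⁻ z, (Measure.pi fun i => labelMeasure (w (z i)))
        {l | z ∈ deviationSet E l (6 * ε * N) (N * ∫ x, w x * (1 - w x) ∂ν)}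
        ∂Measure.pi (fun _ : Fin N => ν) ≤
      ENNReal.ofReal (6 * Real.exp (-(2 * ε ^ 2) * N)) := by
  have hp := fun x => isProbabilityMeasure_labelMeasure (hw01 x)
  have hwint : Integrable w ν := .of_mem_Icc 0 1 hw.aemeasurable (ae_of_all _ hw01)
  obtain ⟨φ, hφc, hφε, hφ, hφint⟩ := hwint.exists_hasCompactSupport_integral_sub_le hε
  have huc := hφc.uniformContinuous_of_continuous hφ
  obtain ⟨r, hr, hrφ⟩ := Metric.uniformContinuous_iff.1 huc ε hε
  obtain ⟨C, hC⟩ := hK.exists_card_long_pairs_le hr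
  obtain ⟨N₀, hN₀⟩ := exists_nat_ge ((C + 1) / ε)
  -- Truncation at 1 makes Hoeffding's inequality applicable to `v`; the bound `hwφ` survives
  -- because `w` oscillates by at most 1.
  set v : E → ℝ := fun x => min |w x - φ x| 1 with hvdef
  have hvm : Measurable v := ((hw.sub hφ.measurable).abs).min measurable_const
  have hv01 : ∀ x, v x ∈ Set.Icc 0 1 := fun x =>
    ⟨le_min (abs_nonneg _) zero_le_one, min_le_right _ _⟩
  have hvε : ∫ x, v x ∂ν ≤ ε := by
    refine le_trans (integral_mono (.of_mem_Icc 0 1 hvm.aemeasurable (ae_of_all _ hv01))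
      (hwint.sub hφint).norm fun x => ?_) hφε
    exact min_le_left _ _
  set u : E → ℝ := fun x => w x * (1 - w x) with hudef
  have hum : Measurable u := hw.mul (measurable_const.sub hw)
  have hu01 : ∀ x, u x ∈ Set.Icc 0 1 := fun x =>
    ⟨mul_nonneg (hw01 x).1 (by linarith [(hw01 x).2]),
      by simp only [hudef]; nlinarith [(hw01 x).1, (hw01 x).2]⟩
  have hwφ : ∀ x y, dist x y < r → |w x - w y| ≤ v x + v y + ε := by
    intro x y hxy
    have h1 : |w x - w y| ≤ 1 := by
      rw [abs_le]
      constructor <;> linarith [(hw01 x).1, (hw01 y).1, (hw01 x).2, (hw01 y).2]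
    by_cases hx : |w x - φ x| ≤ 1
    · by_cases hy : |w y - φ y| ≤ 1
      · have h2 := hrφ hxy
        rw [Real.dist_eq] at h2
        simp only [hvdef, min_eq_left hx, min_eq_left hy]
        have h3 : w x - w y = (w x - φ x) - (w y - φ y) + (φ x - φ y) := by ring
        rw [h3]
        exact (abs_add_le _ _).trans (add_le_add (abs_sub _ _) h2.le)
      · have : v y = 1 := min_eq_right (not_le.1 hy).le
        linarith [(hv01 x).1]
    · have : v x = 1 := min_eq_right (not_le.1 hx).le
      linarith [(hv01 y).1]
  refine ⟨N₀, fun N hN => ?_⟩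
  have hCN : (C : ℝ) + 1 ≤ ε * N := by
    rw [div_le_iff₀ hε] at hN₀
    have : (N₀ : ℝ) ≤ N := by exact_mod_cast hN
    nlinarith
  set Q := Measure.pi (fun _ : Fin N => ν)
  set τ := ENNReal.ofReal (2 * Real.exp (-(2 * ε ^ 2) * N)) with hτ
  set A : Set (Fin N → E) := {z | ε * N ≤ |∑ i, u (z i) - N * ∫ x, u x ∂ν|} with hA
  set B : Set (Fin N → E) := {z | ε * N ≤ |∑ i, v (z i) - N * ∫ x, v x ∂ν|} with hB
  have hAm : MeasurableSet A := measurableSet_le measurable_const (by fun_prop)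
  have hBm : MeasurableSet B := measurableSet_le measurable_const (by fun_prop)
  have hAτ : Q A ≤ τ := measure_pi_abs_sum_sub_ge_le ν hum hu01 N hε.le
  have hBτ : Q B ≤ τ := measure_pi_abs_sum_sub_ge_le ν hvm hv01 N hε.le
  have hzK : ∀ᵐ z ∂Q, ∀ i, z i ∈ K := by
    rw [ae_all_iff]
    exact fun i => (measurePreserving_eval (fun _ : Fin N => ν) i).quasiMeasurePreserving.ae hνK
  have hpt : ∀ᵐ z ∂Q, (Measure.pi fun i => labelMeasure (w (z i)))
      {l | z ∈ deviationSet E l (6 * ε * N) (N * ∫ x, u x ∂ν)} ≤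
      (A ∪ B).indicator 1 z + τ := by
    filter_upwards [hzK, ae_pi_distinctDistances (ι := Fin N) ν hν] with z hz hdist
    by_cases hAB : z ∈ A ∪ B
    · rw [Set.indicator_of_mem hAB]
      exact prob_le_one.trans le_self_add
    rw [Set.indicator_of_notMem hAB, zero_add]
    simp only [Set.mem_union, not_or, hA, hB, Set.mem_ofPred_eq, not_le] at hAB
    by_cases hG : ∃ G, IsGreedyMatching z G
    · obtain ⟨G, hG⟩ := hG
      obtain ⟨P, hP⟩ := GreedyRun.exists_pairs hG
      have hmean := hP.abs_sum_sub_le (a := fun i => w (z i)) (v := fun i => v (z i))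
        (fun i => hw01 _) (fun i => (hv01 _).1) hε.le (fun i j => hwφ _ _) (hC N z _ G P hz hP)
      have hlab := hP.measure_labelCount_le (a := fun i => w (z i)) (fun i => hw01 _) hε.le
      simp only [Fintype.card_fin] at hmean hlab
      refine (measure_mono ?_).trans hlab
      rintro l ⟨G', hG', hdev⟩
      obtain rfl := GreedyRun.unique hdist hG hG'
      simp only [Set.mem_ofPred_eq]
      by_contra! hlt
      obtain ⟨hA1, hB1⟩ := hAB
      have hvN : N * ∫ x, v x ∂ν ≤ ε * N := by
        rw [mul_comm]
        exact mul_le_mul_of_nonneg_right hvε (Nat.cast_nonneg N)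
      have hB2 := (abs_lt.1 hB1).2
      have h1 := abs_lt.1 hlt
      have h2 := abs_lt.1 hA1
      have h3 := abs_le.1 hmean
      simp only [hudef] at h2 hdev
      -- The six shares of `ε N`: one for the labels, two for the sum of `v` (its mean and its
      -- fluctuation), one for the modulus of continuity, one for `C + 1`, one for the sum of `u`.
      rcases le_abs.1 hdev with h | h <;> linarith
    -- Existence of a greedy matching is not needed: without one, the event is empty.
    · have : {l : Fin N → Bool | z ∈ deviationSet E l (6 * ε * N) (N * ∫ x, u x ∂ν)} = ∅ := by
        ext l
        simp only [Set.mem_ofPred_eq, Set.mem_empty_iff_false, iff_false]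
        rintro ⟨G, h, -⟩
        exact hG ⟨G, h⟩
      simp [this]
  -- The events `A`, `B` and the label deviation each cost `τ`, whence the factor `6 = 3 · 2`.
  refine (lintegral_mono_ae hpt).trans ?_
  rw [lintegral_add_right _ measurable_const, lintegral_indicator_one (hAm.union hBm),
    lintegral_const, measure_univ, mul_one]
  refine (add_le_add_left ((measure_union_le A B).trans (add_le_add hAτ hBτ)) _).trans ?_
  rw [hτ, ← ENNReal.ofReal_add (by positivity) (by positivity),
    ← ENNReal.ofReal_add (by positivity) (by positivity)]
  exact ENNReal.ofReal_le_ofReal (by linarith)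

/-- Only the labellings with exactly `m` values `true` are kept in the sum over labellings. There
are `(m + n).choose m` of them, all of equal weight, and by symmetry each deviates with the same
probability. -/
theorem exists_choose_mul_measure_deviationSet_le (ν : Measure E) [IsProbabilityMeasure ν]
    (hν : ∀ x r, ν (Metric.sphere x r) = 0) {K : Set E} (hK : IsCompact K) (hνK : ∀ᵐ x ∂ν, x ∈ K)
    {w : E → ℝ} (hw : Measurable w) (hw01 : ∀ x, w x ∈ Set.Icc 0 1) (κ : Bool → Measure E)
    [∀ b, IsProbabilityMeasure (κ b)] {q : Bool → ENNReal} (hq : ∀ b, q b ≠ ⊤)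
    (hκ : ∀ b, q b • κ b = ν.withDensity fun x => labelMeasure (w x) {b})
    {ε : ℝ} (hε : 0 < ε) :
    ∃ N₀ : ℕ, ∀ m n, N₀ ≤ m + n →
      ((m + n).choose m : ENNReal) * q true ^ m * q false ^ n *
        Measure.pi (fun i : Fin (m + n) => κ (decide ((i : ℕ) < m)))
          (deviationSet E (fun i : Fin (m + n) => decide ((i : ℕ) < m)) (6 * ε * (m + n : ℕ))
            ((m + n : ℕ) * ∫ x, w x * (1 - w x) ∂ν)) ≤
      ENNReal.ofReal (6 * Real.exp (-(2 * ε ^ 2) * (m + n : ℕ))) := by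
  obtain ⟨N₀, hN₀⟩ := exists_lintegral_deviation_le ν hν hK hνK hw hw01 hε
  refine ⟨N₀, fun m n hN => ?_⟩
  have h := hN₀ (m + n) hN
  rw [← sum_prod_mul_measure_eq_lintegral ν κ hw hw01 hq hκ] at h
  refine le_trans ?_ h
  set l₀ : Fin (m + n) → Bool := fun i => decide ((i : ℕ) < m) with hl₀
  set t : ℝ := 6 * ε * (m + n : ℕ)
  set c : ℝ := (m + n : ℕ) * ∫ x, w x * (1 - w x) ∂ν
  have hcard₀ : Fintype.card {i // l₀ i = true} = m := by
    simp [Fintype.card_subtype, hl₀, Fin.card_filter_val_lt]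
  let T : Finset (Fin (m + n) → Bool) := Finset.univ.filter fun l =>
    Fintype.card {i // l i = true} = m
  have hT : T.card = (m + n).choose m := by
    have : T.card = (Finset.powersetCard m (Finset.univ : Finset (Fin (m + n)))).card := by
      refine Finset.card_nbij' (fun l => Finset.univ.filter fun i => l i = true)
        (fun s i => decide (i ∈ s)) ?_ ?_ ?_ ?_
      · intro l hl
        simpa [T, Fintype.card_subtype, Finset.mem_powersetCard] using hl
      · intro s hs
        simpa [T, Fintype.card_subtype, Finset.mem_powersetCard] using hs
      · intro l _
        funext i
        simp
      · intro s _
        ext i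
        simp
    rw [this, Finset.card_powersetCard, Finset.card_univ, Fintype.card_fin]
  refine le_trans ?_ (Finset.sum_le_sum_of_subset (Finset.subset_univ T))
  have hterm : ∀ l ∈ T, q true ^ m * q false ^ n *
      Measure.pi (fun i => κ (l₀ i)) (deviationSet E l₀ t c) ≤
      (∏ i, q (l i)) * Measure.pi (fun i => κ (l i)) (deviationSet E l t c) := by
    intro l hl
    have hlm : Fintype.card {i // l i = true} = m := (Finset.mem_filter.1 hl).2
    have hprod : ∏ i, q (l i) = q true ^ m * q false ^ n := by
      have h1 : (Finset.univ.filter fun i => l i = true).card = m := by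
        rwa [Fintype.card_subtype] at hlm
      have h2 : (Finset.univ.filter fun i => ¬ l i = true).card = n := by
        have := Finset.card_filter_add_card_filter_not (s := (Finset.univ : Finset (Fin (m + n))))
          (fun i => l i = true)
        rw [h1, Finset.card_univ, Fintype.card_fin] at this
        omega
      have h3 : ∏ i with l i = true, q (l i) = q true ^ m := by
        rw [Finset.prod_congr rfl fun i hi => congrArg q (Finset.mem_filter.1 hi).2,
          Finset.prod_const, h1]
      have h4 : ∏ i with ¬ l i = true, q (l i) = q false ^ n := by
        rw [Finset.prod_congr rfl fun i hi =>
          congrArg q (Bool.eq_false_of_not_eq_true (Finset.mem_filter.1 hi).2),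
          Finset.prod_const, h2]
      rw [← Finset.prod_filter_mul_prod_filter_not Finset.univ (fun i => l i = true), h3, h4]
    rw [hprod]
    refine mul_le_mul_right ?_ _
    exact measure_deviationSet_le_of_card_eq κ (hcard₀.trans hlm.symm) t c
  refine le_trans (le_of_eq ?_) (Finset.card_nsmul_le_sum T _ _ hterm)
  rw [hT, nsmul_eq_mul]
  ring

end SumBound

/-! ### Lower bound for binomial probabilities. -/

section Binomial

/-- A crude Stirling bound. The factor `k + 1`, rather than `k`, keeps it true at `k = 0`. -/
theorem factorial_mul_exp_le (k : ℕ) :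
    (k.factorial : ℝ) * Real.exp k ≤ Real.exp 1 * (k + 1) * (k : ℝ) ^ k := by
  have key : ∀ k : ℕ, 1 ≤ k →
      (k.factorial : ℝ) * Real.exp k ≤ Real.exp 1 * (k : ℝ) ^ (k + 1) := by
    intro k hk
    induction k, hk using Nat.le_induction with
    | base => simp
    | succ k _ ih =>
      have h1 : (k : ℝ) ^ (k + 1) * Real.exp 1 ≤ ((k : ℝ) + 1) ^ (k + 1) := by
        have h2 : (k : ℝ) / (k + 1) ≤ Real.exp (-(1 / (k + 1))) := by
          have := Real.add_one_le_exp (-(1 / ((k : ℝ) + 1)))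
          refine le_trans (le_of_eq ?_) this
          field_simp
          ring
        have h3 := pow_le_pow_left₀ (by positivity) h2 (k + 1)
        have h4 : ((k + 1 : ℕ) : ℝ) * -(1 / (k + 1)) = -1 := by
          push_cast
          field_simp
        rw [← Real.exp_nat_mul, h4, div_pow, div_le_iff₀ (by positivity), Real.exp_neg] at h3
        calc (k : ℝ) ^ (k + 1) * Real.exp 1
            ≤ ((Real.exp 1)⁻¹ * ((k : ℝ) + 1) ^ (k + 1)) * Real.exp 1 := by gcongr
          _ = _ := by field_simp
      rw [Nat.factorial_succ]
      push_cast
      rw [Real.exp_add]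
      calc ((k : ℝ) + 1) * k.factorial * (Real.exp k * Real.exp 1)
          = (k + 1) * Real.exp 1 * (k.factorial * Real.exp k) := by ring
        _ ≤ (k + 1) * Real.exp 1 * (Real.exp 1 * (k : ℝ) ^ (k + 1)) := by gcongr
        _ = (k + 1) * Real.exp 1 * ((k : ℝ) ^ (k + 1) * Real.exp 1) := by ring
        _ ≤ (k + 1) * Real.exp 1 * ((k : ℝ) + 1) ^ (k + 1) := by gcongr
        _ = _ := by ring
  rcases Nat.eq_zero_or_pos k with rfl | hk
  · simp
  · refine (key k hk).trans ?_
    rw [pow_succ]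
    have : 0 ≤ Real.exp 1 * (k : ℝ) ^ k := by positivity
    nlinarith

theorem exists_le_choose_mul_pow_mul_pow {p : ℝ} (hp0 : 0 < p) (hp1 : p < 1) {η : ℝ}
    (hη : 0 < η) : ∃ δ > 0, ∃ c > 0, ∀ m n : ℕ, (m : ℝ) ≤ (p + δ) * (m + n : ℕ) →
      (n : ℝ) ≤ (1 - p + δ) * (m + n : ℕ) →
      c * Real.exp (-η * (m + n : ℕ)) ≤ (m + n).choose m * p ^ m * (1 - p) ^ n := by
  have hq0 : 0 < 1 - p := sub_pos.2 hp1
  have hs : 0 < min 1 (η / 4) := by positivity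
  set s := min 1 (η / 4) with hs_def
  refine ⟨η / 2 * p * (1 - p), by positivity, s ^ 2 / Real.exp 1 ^ 2, by positivity, ?_⟩
  intro m n hm hn
  set δ := η / 2 * p * (1 - p) with hδ
  have hδ0 : 0 < δ := by positivity
  set N := m + n with hN
  have hmN : (m : ℝ) ≤ N := by exact_mod_cast Nat.le_add_right m n
  have hnN : (n : ℝ) ≤ N := by exact_mod_cast Nat.le_add_left n m
  have hNsum : (N : ℝ) = m + n := by rw [hN]; push_cast; ring
  have hfac : (N.factorial : ℝ) = N.choose m * m.factorial * n.factorial := by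
    rw [hN, Nat.choose_symm_add]
    exact_mod_cast (Nat.add_choose_mul_factorial_mul_factorial m n).symm
  have hNN : (N : ℝ) ^ N ≤ N.factorial * Real.exp N := by
    have := Real.pow_div_factorial_le_exp (N : ℝ) (Nat.cast_nonneg N) N
    rw [div_le_iff₀ (by positivity)] at this
    linarith
  have hbase : ∀ (x : ℝ) (k : ℕ), 0 < x → (k : ℝ) ≤ N → (k : ℝ) ≤ (x + δ) * N →
      (k.factorial : ℝ) * Real.exp k ≤ Real.exp 1 * (N + 1) * (x ^ k *
        Real.exp (δ / x * N) * (N : ℝ) ^ k) := by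
    intro x k hx hkN hk
    refine (factorial_mul_exp_le k).trans ?_
    -- Makes the excess `δ` multiplicative, so that `k ^ k` is at most `(x N) ^ k` times an
    -- exponential of small rate.
    have h1 : x + δ ≤ x * Real.exp (δ / x) := by
      have := Real.add_one_le_exp (δ / x)
      calc x + δ = x * (δ / x + 1) := by field_simp; ring
        _ ≤ _ := by gcongr
    have h2 : (k : ℝ) ≤ x * Real.exp (δ / x) * N := hk.trans (by gcongr)
    have h3 : (k : ℝ) ^ k ≤ x ^ k * Real.exp (δ / x * N) * (N : ℝ) ^ k := by
      refine (pow_le_pow_left₀ (Nat.cast_nonneg k) h2 k).trans ?_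
      rw [mul_pow, mul_pow, ← Real.exp_nat_mul, mul_comm (k : ℝ)]
      gcongr
    gcongr
  have hm' := hbase p m hp0 hmN hm
  have hn' := hbase (1 - p) n hq0 hnN hn
  have hexp : Real.exp (δ / p * N) * Real.exp (δ / (1 - p) * N) = Real.exp (η / 2 * N) := by
    rw [← Real.exp_add]
    congr 1
    rw [hδ]
    field_simp
    ring
  have hNs : s * (N + 1) ≤ Real.exp (η / 4 * N) := by
    have h1 := Real.add_one_le_exp (η / 4 * N)
    have h2 : s * N ≤ η / 4 * N := mul_le_mul_of_nonneg_right (min_le_right _ _) (by positivity)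
    linarith [min_le_left 1 (η / 4)]
  have hNs2 : (s * (N + 1)) ^ 2 ≤ Real.exp (η / 2 * N) := by
    refine (pow_le_pow_left₀ (by positivity) hNs 2).trans (le_of_eq ?_)
    rw [← Real.exp_nat_mul]
    congr 1
    push_cast
    ring
  have hmain : (N : ℝ) ^ N ≤ (N.choose m * p ^ m * (1 - p) ^ n) *
      (Real.exp 1 ^ 2 * (N + 1) ^ 2 * Real.exp (η / 2 * N)) * (N : ℝ) ^ N := by
    calc (N : ℝ) ^ N ≤ N.factorial * Real.exp N := hNN
      _ = N.choose m * ((m.factorial * Real.exp m) * (n.factorial * Real.exp n)) := by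
        rw [hfac, hNsum, Real.exp_add]; ring
      _ ≤ N.choose m * ((Real.exp 1 * (N + 1) * (p ^ m * Real.exp (δ / p * N) * (N : ℝ) ^ m)) *
          (Real.exp 1 * (N + 1) * ((1 - p) ^ n * Real.exp (δ / (1 - p) * N) * (N : ℝ) ^ n))) := by
        gcongr
      _ = _ := by
        rw [← hexp, show (N : ℝ) ^ N = (N : ℝ) ^ m * (N : ℝ) ^ n from pow_add _ _ _]; ring
  have hpos : 0 < (N : ℝ) ^ N := by
    rcases Nat.eq_zero_or_pos N with h | h
    · simp [h]
    · positivity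
  have h1 : 1 ≤ (N.choose m * p ^ m * (1 - p) ^ n) *
      (Real.exp 1 ^ 2 * (N + 1) ^ 2 * Real.exp (η / 2 * N)) :=
    le_of_mul_le_mul_right (by rwa [one_mul]) hpos
  set A := N.choose m * p ^ m * (1 - p) ^ n with hA
  have hA0 : 0 ≤ A := by positivity
  have h2 : s ^ 2 ≤ A * (Real.exp 1 ^ 2 * Real.exp (η * N)) := by
    calc s ^ 2 = s ^ 2 * 1 := by ring
      _ ≤ s ^ 2 * (A * (Real.exp 1 ^ 2 * (N + 1) ^ 2 * Real.exp (η / 2 * N))) := by gcongr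
      _ = A * (Real.exp 1 ^ 2 * ((s * (N + 1)) ^ 2 * Real.exp (η / 2 * N))) := by ring
      _ ≤ A * (Real.exp 1 ^ 2 * (Real.exp (η / 2 * N) * Real.exp (η / 2 * N))) := by gcongr
      _ = _ := by rw [← Real.exp_add]; ring_nf
  rw [neg_mul, Real.exp_neg, ← div_eq_mul_inv, div_div, div_le_iff₀ (by positivity)]
  exact h2

end Binomial

/-! ### Law of the combined sample. -/

section Sample

variable {E : Type*}

theorem combinedSample_eq_sumElim {Ω : Type*} (m n : ℕ) (X Y : ℕ → Ω → E) (ω : Ω)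
    (i : Fin (m + n)) :
    combinedSample m n (fun i => X i ω) (fun j => Y j ω) i =
      Sum.elim X Y (Sum.map Fin.val Fin.val (finSumFinEquiv.symm i)) ω := by
  induction i using Fin.addCases <;> simp [combinedSample]

/-- The law of the combined sample. -/
theorem map_combinedSample [MeasurableSpace E] {Ω : Type*} [MeasurableSpace Ω] {μ : Measure Ω}
    [IsProbabilityMeasure μ] {X Y : ℕ → Ω → E} (hX : ∀ i, Measurable (X i))
    (hY : ∀ j, Measurable (Y j)) {κ : Bool → Measure E} (hXlaw : ∀ i, μ.map (X i) = κ true)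
    (hYlaw : ∀ j, μ.map (Y j) = κ false) (hindep : iIndepFun (Sum.elim X Y) μ) (m n : ℕ) :
    μ.map (fun ω => combinedSample m n (fun i => X i ω) (fun j => Y j ω)) =
      Measure.pi fun i : Fin (m + n) => κ (decide ((i : ℕ) < m)) := by
  have hinj : Function.Injective fun i : Fin (m + n) =>
      Sum.map (Fin.val (n := m)) (Fin.val (n := n)) (finSumFinEquiv.symm i) :=
    (Sum.map_injective.2 ⟨Fin.val_injective, Fin.val_injective⟩).comp finSumFinEquiv.symm.injective
  have hmeas : ∀ s, Measurable (Sum.elim X Y s) := by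
    rintro (i | j)
    · exact hX i
    · exact hY j
  have h := (hindep.precomp hinj).map_fun_eq_pi_map fun i => (hmeas _).aemeasurable
  have h2 : (fun ω => combinedSample m n (fun i => X i ω) (fun j => Y j ω)) = fun ω i =>
      Sum.elim X Y (Sum.map (Fin.val (n := m)) (Fin.val (n := n)) (finSumFinEquiv.symm i)) ω := by
    funext ω i
    exact combinedSample_eq_sumElim m n X Y ω i
  rw [h2, h]
  congr 1
  funext i
  induction i using Fin.addCases with
  | left i => simpa using hXlaw i
  | right j => simpa using hYlaw j

theorem measurable_combinedSample [MeasurableSpace E] {Ω : Type*} [MeasurableSpace Ω]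
    {X Y : ℕ → Ω → E} (hX : ∀ i, Measurable (X i)) (hY : ∀ j, Measurable (Y j)) (m n : ℕ) :
    Measurable fun ω => combinedSample m n (fun i => X i ω) (fun j => Y j ω) := by
  refine measurable_pi_lambda _ fun i => ?_
  induction i using Fin.addCases with
  | left i => simpa [combinedSample] using hX i
  | right j => simpa [combinedSample] using hY j

theorem crossCount_eq_two_mul_labelCount (m n : ℕ) (G : SimpleGraph (Fin (m + n))) :
    crossCount m n G.Adj = 2 * labelCount (fun i : Fin (m + n) => decide ((i : ℕ) < m)) G := by
  simp only [crossCount, labelCount, decide_eq_true_eq, decide_eq_false_iff_not, not_lt, two_mul,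
    G.adj_comm]

end Sample

/-! ### Conditioning on the label count and Borel–Cantelli. -/

section AlmostSure

variable {E : Type*} [MetricSpace E] [ProperSpace E] [SecondCountableTopology E]
  [MeasurableSpace E] [BorelSpace E]

theorem exists_measure_sample_deviation_le (ν : Measure E) [IsProbabilityMeasure ν]
    (hν : ∀ x r, ν (Metric.sphere x r) = 0) {K : Set E} (hK : IsCompact K) (hνK : ∀ᵐ x ∂ν, x ∈ K)
    {w : E → ℝ} (hw : Measurable w) (hw01 : ∀ x, w x ∈ Set.Icc 0 1) (κ : Bool → Measure E)
    [∀ b, IsProbabilityMeasure (κ b)] {p : ℝ} (hp0 : 0 < p) (hp1 : p < 1)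
    (hκt : ENNReal.ofReal p • κ true = ν.withDensity fun x => ENNReal.ofReal (w x))
    (hκf : ENNReal.ofReal (1 - p) • κ false = ν.withDensity fun x => ENNReal.ofReal (1 - w x))
    {ε : ℝ} (hε : 0 < ε) :
    ∃ N₀ : ℕ, ∃ δ > 0, ∃ C : ℝ, ∀ m n, N₀ ≤ m + n → (m : ℝ) ≤ (p + δ) * (m + n : ℕ) →
      (n : ℝ) ≤ (1 - p + δ) * (m + n : ℕ) →
      Measure.pi (fun i : Fin (m + n) => κ (decide ((i : ℕ) < m)))
        (deviationSet E (fun i : Fin (m + n) => decide ((i : ℕ) < m)) (6 * ε * (m + n : ℕ))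
          ((m + n : ℕ) * ∫ x, w x * (1 - w x) ∂ν)) ≤
      ENNReal.ofReal (C * Real.exp (-ε ^ 2 * (m + n : ℕ))) := by
  obtain ⟨N₀, hN₀⟩ := exists_choose_mul_measure_deviationSet_le ν hν hK hνK hw hw01 κ
    (q := fun b => if b then ENNReal.ofReal p else ENNReal.ofReal (1 - p))
    (by simp) (by simp [labelMeasure_singleton, hκt, hκf]) hε
  -- With `η = ε ^ 2`, dividing by the binomial probability uses up only half of the rate `2 ε ^ 2`.
  obtain ⟨δ, hδ, c, hc, hbin⟩ := exists_le_choose_mul_pow_mul_pow hp0 hp1 (sq_pos_of_pos hε)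
  refine ⟨N₀, δ, hδ, 6 / c, fun m n hN hm hn => ?_⟩
  have h1 := hN₀ m n hN
  have h2 := hbin m n hm hn
  set D := Measure.pi (fun i : Fin (m + n) => κ (decide ((i : ℕ) < m)))
        (deviationSet E (fun i : Fin (m + n) => decide ((i : ℕ) < m)) (6 * ε * (m + n : ℕ))
          ((m + n : ℕ) * ∫ x, w x * (1 - w x) ∂ν))
  set x := Real.exp (-ε ^ 2 * (m + n : ℕ)) with hx
  have hx0 : 0 < x := Real.exp_pos _
  have h3 : Real.exp (-(2 * ε ^ 2) * (m + n : ℕ)) = x * x := by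
    rw [hx, ← Real.exp_add]
    ring_nf
  have h4 : ENNReal.ofReal (c * x) * D ≤ ENNReal.ofReal (6 * (x * x)) := by
    rw [← h3]
    refine le_trans (mul_le_mul_left ?_ D) h1
    simp only [if_true, Bool.false_eq_true, if_false]
    rw [← ENNReal.ofReal_pow hp0.le, ← ENNReal.ofReal_pow (sub_pos.2 hp1).le,
      ← ENNReal.ofReal_natCast, ← ENNReal.ofReal_mul (by positivity),
      ← ENNReal.ofReal_mul (by positivity)]
    exact ENNReal.ofReal_le_ofReal h2
  have hcx : ENNReal.ofReal (c * x) ≠ 0 := by simpa using mul_pos hc hx0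
  have h5 : ENNReal.ofReal (6 * (x * x)) =
      ENNReal.ofReal (c * x) * ENNReal.ofReal (6 / c * x) := by
    rw [← ENNReal.ofReal_mul (by positivity)]
    congr 1
    field_simp
  rw [h5] at h4
  exact (ENNReal.mul_le_mul_iff_right hcx ENNReal.ofReal_ne_top).1 h4

theorem tsum_ofReal_exp_lt_top {ε : ℝ} (hε : 0 < ε) (C : ℝ) :
    ∑' q : ℕ × ℕ, ENNReal.ofReal (C * Real.exp (-ε ^ 2 * (q.1 + q.2 : ℕ))) ≠ ⊤ := by
  set r := ENNReal.ofReal (Real.exp (-ε ^ 2)) with hr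
  have hr1 : r < 1 := by
    rw [hr, ENNReal.ofReal_lt_one, Real.exp_lt_one_iff]
    have := sq_pos_of_pos hε
    linarith
  have hterm : ∀ q : ℕ × ℕ, ENNReal.ofReal (C * Real.exp (-ε ^ 2 * (q.1 + q.2 : ℕ))) =
      ENNReal.ofReal C * (r ^ q.1 * r ^ q.2) := by
    intro q
    rw [ENNReal.ofReal_mul' (Real.exp_pos _).le, mul_comm (-ε ^ 2), Real.exp_nat_mul,
      ENNReal.ofReal_pow (Real.exp_pos _).le, pow_add]
  simp_rw [hterm]
  rw [ENNReal.tsum_mul_left, ENNReal.tsum_prod']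
  simp_rw [ENNReal.tsum_mul_left]
  rw [ENNReal.tsum_mul_right, ENNReal.tsum_geometric]
  have : (1 - r)⁻¹ ≠ ⊤ := ENNReal.inv_ne_top.2 (tsub_pos_of_lt hr1).ne'
  exact ENNReal.mul_ne_top ENNReal.ofReal_ne_top (ENNReal.mul_ne_top this this)

/-- The almost sure limit, for a mixture `ν = p κ true + (1 - p) κ false` in which a point at `x`
comes from the first component with conditional probability `w x`. -/
theorem ae_tendsto_crossCount (ν : Measure E) [IsProbabilityMeasure ν]
    (hν : ∀ x r, ν (Metric.sphere x r) = 0) {K : Set E} (hK : IsCompact K) (hνK : ∀ᵐ x ∂ν, x ∈ K)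
    {w : E → ℝ} (hw : Measurable w) (hw01 : ∀ x, w x ∈ Set.Icc 0 1) (κ : Bool → Measure E)
    [∀ b, IsProbabilityMeasure (κ b)] {p : ℝ} (hp0 : 0 < p) (hp1 : p < 1)
    (hκt : ENNReal.ofReal p • κ true = ν.withDensity fun x => ENNReal.ofReal (w x))
    (hκf : ENNReal.ofReal (1 - p) • κ false = ν.withDensity fun x => ENNReal.ofReal (1 - w x))
    {Ω : Type*} [MeasurableSpace Ω] (μ : Measure Ω) [IsProbabilityMeasure μ]
    {X Y : ℕ → Ω → E} (hX : ∀ i, Measurable (X i)) (hY : ∀ j, Measurable (Y j))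
    (hXlaw : ∀ i, μ.map (X i) = κ true) (hYlaw : ∀ j, μ.map (Y j) = κ false)
    (hindep : iIndepFun (Sum.elim X Y) μ)
    {m n : ℕ → ℕ} (hmn : Tendsto (fun k => m k + n k) atTop atTop)
    (hmp : Tendsto (fun k => (m k : ℝ) / ((m k : ℝ) + (n k : ℝ))) atTop (𝓝 p)) :
    ∀ᵐ ω ∂μ, ∀ G : (k : ℕ) → SimpleGraph (Fin (m k + n k)),
      (∀ k, IsGreedyMatching
        (combinedSample (m k) (n k) (fun i => X i ω) (fun j => Y j ω)) (G k)) →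
      Tendsto (fun k => (crossCount (m k) (n k) (G k).Adj : ℝ) / ((m k : ℝ) + (n k : ℝ))) atTop
        (𝓝 (2 * ∫ x, w x * (1 - w x) ∂ν)) := by
  set J := ∫ x, w x * (1 - w x) ∂ν
  let Z : (m n : ℕ) → Ω → Fin (m + n) → E := fun m n ω =>
    combinedSample m n (fun i => X i ω) (fun j => Y j ω)
  have key : ∀ ε > 0, ∀ᵐ ω ∂μ, ∀ᶠ k in atTop, ∀ G : SimpleGraph (Fin (m k + n k)),
      IsGreedyMatching (Z (m k) (n k) ω) G →
      |(labelCount (fun i : Fin (m k + n k) => decide ((i : ℕ) < m k)) G : ℝ) -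
        (m k + n k : ℕ) * J| < 6 * ε * (m k + n k : ℕ) := by
    intro ε hε
    obtain ⟨N₀, δ, hδ, C, hC⟩ := exists_measure_sample_deviation_le ν hν hK hνK hw hw01 κ hp0 hp1
      hκt hκf hε
    let good : ℕ × ℕ → Prop := fun q => N₀ ≤ q.1 + q.2 ∧
      (q.1 : ℝ) ≤ (p + δ) * (q.1 + q.2 : ℕ) ∧ (q.2 : ℝ) ≤ (1 - p + δ) * (q.1 + q.2 : ℕ)
    -- Bad events are indexed by sample sizes, not by `k`: if `m k + n k` grows slowly, a sum over
    -- `k` may diverge, while the sum over all pairs of sizes is a product of geometric series.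
    let s : ℕ × ℕ → Set Ω := fun q => {ω | good q ∧ Z q.1 q.2 ω ∈
      deviationSet E (fun i : Fin (q.1 + q.2) => decide ((i : ℕ) < q.1))
        (6 * ε * (q.1 + q.2 : ℕ)) ((q.1 + q.2 : ℕ) * J)}
    have hs : ∀ q, μ (s q) ≤ ENNReal.ofReal (C * Real.exp (-ε ^ 2 * (q.1 + q.2 : ℕ))) := by
      intro q
      by_cases hq : good q
      · refine le_trans ?_ (hC q.1 q.2 hq.1 hq.2.1 hq.2.2)
        rw [← map_combinedSample hX hY hXlaw hYlaw hindep, Measure.map_apply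
          (measurable_combinedSample hX hY _ _) (measurableSet_deviationSet _ _ _)]
        exact measure_mono fun ω hω => hω.2
      · have : s q = ∅ := by
          ext ω
          simp [s, hq]
        simp [this]
    have hsum : ∑' q, μ (s q) ≠ ⊤ :=
      ne_top_of_le_ne_top (tsum_ofReal_exp_lt_top hε C) (ENNReal.tsum_le_tsum hs)
    have hgood : ∀ᶠ k in atTop, good (m k, n k) := by
      filter_upwards [hmn.eventually_ge_atTop N₀, hmn.eventually_gt_atTop 0,
        hmp.eventually (eventually_le_nhds (show p < p + δ by linarith)),
        hmp.eventually (eventually_ge_nhds (show p - δ < p by linarith))] with k h1 h0 h2 h3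
      have hpos : (0 : ℝ) < (m k : ℝ) + n k := by exact_mod_cast h0
      rw [div_le_iff₀ hpos] at h2
      rw [le_div_iff₀ hpos] at h3
      refine ⟨h1, ?_, ?_⟩ <;> push_cast <;> linarith
    filter_upwards [ae_finite_setOfPred_mem hsum] with ω hω
    -- Only finitely many sizes are bad, and `m k + n k → ∞` eventually leaves them all.
    have hcof : ∀ᶠ k in atTop, (m k, n k) ∉ {q | ω ∈ s q} := by
      obtain ⟨M, hM⟩ := (hω.image fun q : ℕ × ℕ => q.1 + q.2).bddAbove
      filter_upwards [hmn.eventually_gt_atTop M] with k hk hmem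
      exact absurd (hM ⟨_, hmem, rfl⟩) (not_le.2 hk)
    filter_upwards [hgood, hcof] with k hk1 hk2 G hG
    by_contra! hle
    exact hk2 ⟨hk1, G, hG, hle⟩
  have key' : ∀ᵐ ω ∂μ, ∀ j : ℕ, ∀ᶠ k in atTop, ∀ G : SimpleGraph (Fin (m k + n k)),
      IsGreedyMatching (Z (m k) (n k) ω) G →
      |(labelCount (fun i : Fin (m k + n k) => decide ((i : ℕ) < m k)) G : ℝ) -
        (m k + n k : ℕ) * J| < 6 * (1 / ((j : ℝ) + 1)) * (m k + n k : ℕ) :=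
    ae_all_iff.2 fun j => key _ (by positivity)
  filter_upwards [key'] with ω hω G hG
  rw [Metric.tendsto_nhds]
  intro ε hε
  -- The factor 12 is the 6 of the deviation bound times the 2 from counting both directions.
  obtain ⟨j, hj⟩ := exists_nat_one_div_lt (show 0 < ε / 12 by positivity)
  filter_upwards [hω j, hmn.eventually_gt_atTop 0] with k hk h0
  have hpos : (0 : ℝ) < (m k : ℝ) + n k := by exact_mod_cast h0
  have h := hk (G k) (hG k)
  rw [Real.dist_eq, crossCount_eq_two_mul_labelCount]
  push_cast at h ⊢
  set L := (labelCount (fun i : Fin (m k + n k) => decide ((i : ℕ) < m k)) (G k) : ℝ)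
  have heq : 2 * L / ((m k : ℝ) + n k) - 2 * J =
      2 * (L - ((m k : ℝ) + n k) * J) / ((m k : ℝ) + n k) := by
    field_simp
  rw [heq, abs_div, abs_mul, abs_of_pos hpos, div_lt_iff₀ hpos, abs_two]
  nlinarith

end AlmostSure

/-! ### Densities: reduction of the theorem to the mixture. -/

theorem withDensity_mul_ofReal_div {E : Type*} [MeasurableSpace E] (μ : Measure E) {h a w : E → ℝ}
    (hh : Measurable h) (hh0 : ∀ x, 0 ≤ h x) (hw : Measurable w)
    (hwa : ∀ x, h x * w x = a x) :
    (μ.withDensity fun x => ENNReal.ofReal (h x)).withDensity (fun x => ENNReal.ofReal (w x)) =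
      μ.withDensity fun x => ENNReal.ofReal (a x) := by
  rw [← withDensity_mul μ hh.ennreal_ofReal hw.ennreal_ofReal]
  congr 1
  funext x
  rw [Pi.mul_apply, ← ENNReal.ofReal_mul (hh0 x), hwa]

theorem ofReal_smul_densityMeasure {d : ℕ} {f : EuclideanSpace ℝ (Fin d) → ℝ} (hf : Measurable f)
    {p : ℝ} (hp : 0 ≤ p) :
    ENNReal.ofReal p • densityMeasure f =
      volume.withDensity fun x => ENNReal.ofReal (p * f x) := by
  rw [densityMeasure, ← withDensity_smul _ hf.ennreal_ofReal]
  congr 1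
  funext x
  rw [Pi.smul_apply, smul_eq_mul, ENNReal.ofReal_mul hp]

theorem corollary2 {d : ℕ} (hd : 1 ≤ d)
    {Ω : Type*} [MeasurableSpace Ω] (μ : Measure Ω) [IsProbabilityMeasure μ]
    (f g : EuclideanSpace ℝ (Fin d) → ℝ)
    (hf : Measurable f) (hf0 : ∀ z, 0 ≤ f z) (hg : Measurable g) (hg0 : ∀ z, 0 ≤ g z)
    (hfsupp : IsCompact (densityMeasure f).support)
    (hgsupp : IsCompact (densityMeasure g).support)
    (X Y : ℕ → Ω → EuclideanSpace ℝ (Fin d))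
    (hX : ∀ i, Measurable (X i)) (hY : ∀ j, Measurable (Y j))
    (hXlaw : ∀ i, μ.map (X i) = densityMeasure f)
    (hYlaw : ∀ j, μ.map (Y j) = densityMeasure g)
    (hindep : iIndepFun (Sum.elim X Y) μ)
    (p : ℝ) (hp0 : 0 < p) (hp1 : p < 1)
    (m n : ℕ → ℕ) (hmn : Tendsto (fun k => m k + n k) atTop atTop)
    (hmp : Tendsto (fun k => (m k : ℝ) / ((m k : ℝ) + (n k : ℝ))) atTop (𝓝 p)) :
    ∀ᵐ ω ∂μ, ∀ G : (k : ℕ) → SimpleGraph (Fin (m k + n k)),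
      (∀ k, IsGreedyMatching
        (combinedSample (m k) (n k) (fun i => X i ω) (fun j => Y j ω)) (G k)) →
      Tendsto (fun k => (crossCount (m k) (n k) (G k).Adj : ℝ) / ((m k : ℝ) + (n k : ℝ))) atTop
        (𝓝 (∫ z, 2 * p * (1 - p) * f z * g z / (p * f z + (1 - p) * g z))) := by
  have hq0 : 0 < 1 - p := sub_pos.2 hp1
  -- Makes the space nontrivial, so that all spheres, including those of radius 0, are Lebesgue
  -- null.
  have : Nonempty (Fin d) := ⟨⟨0, hd⟩⟩
  have hfprob : IsProbabilityMeasure (densityMeasure f) :=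
    hXlaw 0 ▸ Measure.isProbabilityMeasure_map (hX 0).aemeasurable
  have hgprob : IsProbabilityMeasure (densityMeasure g) :=
    hYlaw 0 ▸ Measure.isProbabilityMeasure_map (hY 0).aemeasurable
  set h : EuclideanSpace ℝ (Fin d) → ℝ := fun z => p * f z + (1 - p) * g z with hh
  set w : EuclideanSpace ℝ (Fin d) → ℝ := fun z => p * f z / h z with hw
  have hpf0 : ∀ z, 0 ≤ p * f z := fun z => mul_nonneg hp0.le (hf0 z)
  have hqg0 : ∀ z, 0 ≤ (1 - p) * g z := fun z => mul_nonneg hq0.le (hg0 z)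
  have hh0 : ∀ z, 0 ≤ h z := fun z => add_nonneg (hpf0 z) (hqg0 z)
  have hhm : Measurable h := (hf.const_mul p).add (hg.const_mul (1 - p))
  have hwm : Measurable w := (hf.const_mul p).div hhm
  have hw01 : ∀ z, w z ∈ Set.Icc 0 1 := fun z =>
    ⟨div_nonneg (hpf0 z) (hh0 z), div_le_one_of_le₀ (le_add_of_nonneg_right (hqg0 z)) (hh0 z)⟩
  have hhw : ∀ z, h z * w z = p * f z := by
    intro z
    -- Where `h` vanishes so does `p f`, and the value of `w` there (0, by the division convention)
    -- is irrelevant.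
    rcases eq_or_ne (h z) 0 with hz | hz
    · have : p * f z = 0 := le_antisymm (by simp only [hh] at hz; linarith [hqg0 z]) (hpf0 z)
      rw [hz, this, zero_mul]
    · exact mul_div_cancel₀ _ hz
  have hhw' : ∀ z, h z * (1 - w z) = (1 - p) * g z := by
    intro z
    rw [mul_sub, hhw, hh]
    ring
  set ν := volume.withDensity fun z => ENNReal.ofReal (h z) with hν
  have hνsum : ν = ENNReal.ofReal p • densityMeasure f +
      ENNReal.ofReal (1 - p) • densityMeasure g := by
    rw [ofReal_smul_densityMeasure hf hp0.le, ofReal_smul_densityMeasure hg hq0.le,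
      ← withDensity_add_left (hf.const_mul p).ennreal_ofReal, hν]
    congr 1
    funext z
    rw [Pi.add_apply, ← ENNReal.ofReal_add (hpf0 z) (hqg0 z)]
  have hνprob : IsProbabilityMeasure ν := by
    constructor
    rw [hνsum]
    simp only [Measure.add_apply, Measure.smul_apply, measure_univ, smul_eq_mul, mul_one]
    rw [← ENNReal.ofReal_add hp0.le hq0.le]
    simp
  have hνsphere : ∀ x r, ν (Metric.sphere x r) = 0 := fun x r =>
    withDensity_absolutelyContinuous _ _ (Measure.addHaar_sphere volume x r)
  have hνK : ∀ᵐ x ∂ν, x ∈ (densityMeasure f).support ∪ (densityMeasure g).support := by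
    rw [hνsum, ae_add_measure_iff]
    refine ⟨Measure.ae_smul_measure ?_ _, Measure.ae_smul_measure ?_ _⟩
    · filter_upwards [Measure.support_mem_ae (μ := densityMeasure f)] with x hx using Or.inl hx
    · filter_upwards [Measure.support_mem_ae (μ := densityMeasure g)] with x hx using Or.inr hx
  let κ : Bool → Measure (EuclideanSpace ℝ (Fin d)) := fun b =>
    if b then densityMeasure f else densityMeasure g
  have hκprob : ∀ b, IsProbabilityMeasure (κ b) := by
    rintro (_ | _)
    · exact hgprob
    · exact hfprob
  have hκt : ENNReal.ofReal p • κ true = ν.withDensity fun x => ENNReal.ofReal (w x) :=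
    (ofReal_smul_densityMeasure hf hp0.le).trans
      (withDensity_mul_ofReal_div volume hhm hh0 hwm hhw).symm
  have hκf : ENNReal.ofReal (1 - p) • κ false = ν.withDensity fun x => ENNReal.ofReal (1 - w x) :=
    (ofReal_smul_densityMeasure hg hq0.le).trans
      (withDensity_mul_ofReal_div volume hhm hh0 (measurable_const.sub hwm) hhw').symm
  have hlim : 2 * ∫ x, w x * (1 - w x) ∂ν =
      ∫ z, 2 * p * (1 - p) * f z * g z / (p * f z + (1 - p) * g z) := by
    rw [hν, integral_withDensity_eq_integral_toReal_smul hhm.ennreal_ofReal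
      (ae_of_all _ fun _ => ENNReal.ofReal_lt_top), ← integral_const_mul]
    refine integral_congr_ae (ae_of_all _ fun z => ?_)
    simp only [ENNReal.toReal_ofReal (hh0 z), smul_eq_mul]
    rw [show 2 * (h z * (w z * (1 - w z))) = 2 * (w z * (h z * (1 - w z))) by ring, hhw']
    simp only [hw, hh]
    ring
  rw [← hlim]
  exact ae_tendsto_crossCount ν hνsphere (hfsupp.union hgsupp) hνK hwm hw01 κ hp0 hp1 hκt hκf μ
    hX hY hXlaw hYlaw hindep hmn hmp
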